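/- For a prime $q$ let $\mathcal X$ be the group of Dirichlet characters modulo $q$, and let $\mathcal L=\sqrt{\log q/\log\log q}$. A character $\chi$ is even if $\chi(-1)=1$ and odd if $\chi(-1)=-1$. Let $\varepsilon>0$ and $C>0$ be fixed. Let $q\to\infty$ through the primes, and let $H\le\mathcal X$ be any subgroup whose index $K=[\mathcal X:H]$ satisfies $K\le C(\log q)^{1-\varepsilon}$. If a coset $\chi_1H$ $(\chi_1\in\mathcal X)$ contains both even and odd characters, then $$\max_{\chi\in\chi_1H}|L(\chi,1/2)|\ge\exp\left(\frac{1}{\sqrt{2K-1}}\left(\frac1{\sqrt3}+o(1)\right)\mathcal L\right).$$ If a coset $\chi_2H$ $(\chi_2\in\mathcal X)$ consists only of even characters or only of odd characters (which forces $K\ge2$ for $q>2$), then $$\max_{\chi\in\chi_2H}|L(\chi,1/2)|\ge\exp\left(\frac{1}{\sqrt{K-1}}\left(\frac1{\sqrt3}+o(1)\right)\mathcal L\right).$$ Here $o(1)$ denotes a quantity that tends to $0$ as $q\to\infty$, at a rate depending only on $\varepsilon$ and $C$ (uniformly in $H$ and in the coset). -/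

import Mathlib

open scoped Pointwise

/-- The scale `√(log q / log log q)`. -/
noncomputable def scaleL (q : ℕ) : ℝ :=
  Real.sqrt (Real.log q / Real.log (Real.log q))

/-- The set of the numbers `|L(χ, 1/2)|`, where `χ` runs through the set `S` of Dirichlet
characters modulo `q`. -/
def centralAbsValues {q : ℕ} [NeZero q] (S : Set (DirichletCharacter ℂ q)) : Set ℝ :=
  (fun χ : DirichletCharacter ℂ q => ‖DirichletCharacter.LFunction χ (1 / 2)‖) '' S

/-! The proof is the resonance method, averaged over one coset. With $R(\chi)=\sum_{n\le
N}r(n)\chi(n)$ and $r\ge0$, the maximum of $|L(\chi,1/2)|$ over the coset is at least $|\sum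
L(\chi,1/2)|R(\chi)|^2|$ divided by $\sum|R(\chi)|^2$.

Orthogonality on a coset is only partial. If $\sum\chi(x)\overline{\chi(y)}\ne0$, all characters in
$H$ agree at $x$ and $y$. Every $K$-th power of a character lies in $H$, so $x^K=y^K$ in $\mathbb
F_q$ (`pow_index_eq_of_cosetSum_ne_zero`). For positive integers up to $B<q$ with $KB^{K-1}<q$ this
forces $x=y$ (`eq_of_pow_zmod_eq_of_le`).

The central value is exactly a combination of the $\chi(a)$, $a$ modulo $q$, with Hurwitz zeta
coefficients $1/\sqrt a+O(1/\sqrt q)$; neither a functional equation nor the parity of $\chi$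
enters. Given $m,n\le N$, at most $K$ residues $a$ satisfy $(am)^K=n^K$. If $L_0N\le B$, those with
$a\le L_0$ satisfy $am=n$, and the others have coefficient $O(1/\sqrt{L_0})$. The ratio of averages
is therefore $\sum_{m\mid n}r(m)r(n)\sqrt{m/n}\,/\sum r(n)^2$ up to $O(KN/\sqrt{L_0})$
(`exists_mem_coset_norm_LFunction_ge`).

With $B\approx q^{1/\max(K-1,1)}$, $L_0\approx B^{2/3}$ and $N$ slightly below $B^{1/3}$ the error
is small; this cube root is the source of $1/\sqrt3$. Soundararajan's resonator (`exists_resonator`)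
makes the main term at least $\exp((1-o(1))\sqrt{\log N/\log\log N})$. The bound on $K$ keeps $\log
N\gg(\log q)^\varepsilon$, which gives uniformity. Since $\max(K-1,1)\le2K-1$, mixed cosets are
covered as well. -/

/-! ### Mertens' theorem and sums of $1/(p\log p)$ -/

/-- The weight `log p / p` on primes, extended by zero. -/
noncomputable def logDivPrime (n : ℕ) : ℝ := if n.Prime then Real.log n / n else 0

theorem log_factorial_eq_sum_padicValNat (n : ℕ) :
    Real.log (n.factorial : ℝ) =
      ∑ p ∈ Finset.Ioc 0 n with p.Prime, (padicValNat p n.factorial : ℝ) * Real.log p := by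
  rw [Real.log_nat_eq_sum_factorization, Finsupp.sum]
  refine (Finset.sum_subset (fun p hp => ?_) (fun p hp hp' => ?_)).trans
    (Finset.sum_congr rfl fun p hp => ?_)
  · have h := Nat.prime_of_mem_primeFactors hp
    have h2 := Nat.dvd_of_mem_primeFactors hp
    simp only [Finset.mem_filter, Finset.mem_Ioc]
    exact ⟨⟨h.pos, (h.dvd_factorial).1 h2⟩, h⟩
  · rw [Finsupp.notMem_support_iff.1 hp']
    simp
  · rw [Nat.factorization_def _ (Finset.mem_filter.1 hp).2]

theorem div_sub_one_le_padicValNat_factorial {p : ℕ} (hp : p.Prime) (n : ℕ) :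
    (n : ℝ) / p - 1 ≤ padicValNat p n.factorial := by
  have := Fact.mk hp
  have h1 : n / p ≤ padicValNat p n.factorial := by
    rw [← padicValNat_mul_div_factorial n, padicValNat_factorial_mul]
    exact Nat.le_add_left _ _
  have h2 : (n : ℝ) / p < (n / p : ℕ) + 1 := by
    rw [div_lt_iff₀ (by exact_mod_cast hp.pos)]
    exact_mod_cast Nat.lt_mul_of_div_lt (Nat.lt_succ_self _) hp.pos
  have h3 : ((n / p : ℕ) : ℝ) ≤ padicValNat p n.factorial := by exact_mod_cast h1
  linarith

theorem padicValNat_factorial_le_div {p : ℕ} (hp : p.Prime) (n : ℕ) :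
    (padicValNat p n.factorial : ℝ) ≤ n / ((p : ℝ) - 1) := by
  have := Fact.mk hp
  have h : (p - 1) * padicValNat p n.factorial ≤ n := by
    rw [sub_one_mul_padicValNat_factorial]; exact Nat.sub_le _ _
  have hp1 : (1 : ℝ) < p := by exact_mod_cast hp.one_lt
  rw [le_div_iff₀ (by linarith), mul_comm]
  have : (((p - 1) * padicValNat p n.factorial : ℕ) : ℝ) ≤ n := by exact_mod_cast h
  rwa [Nat.cast_mul, Nat.cast_pred hp.pos] at this

/-- This bounds the cost of replacing $1/(p-1)$, which Legendre's formula produces, by $1/p$. The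
terms are $O(p^{-3/2})$. -/
theorem sum_log_div_mul_pred_le_const : ∃ c : ℝ, 0 ≤ c ∧ ∀ s : Finset ℕ, (∀ p ∈ s, 2 ≤ p) →
    ∑ p ∈ s, Real.log p / ((p : ℝ) * (p - 1)) ≤ c := by
  have hs : Summable (fun n : ℕ => 4 * (1 / (n : ℝ) ^ (3 / 2 : ℝ))) :=
    (Real.summable_one_div_nat_rpow.2 (by norm_num)).mul_left 4
  have hnn : ∀ n : ℕ, 0 ≤ 4 * (1 / (n : ℝ) ^ (3 / 2 : ℝ)) := fun n => by positivity
  refine ⟨∑' n : ℕ, 4 * (1 / (n : ℝ) ^ (3 / 2 : ℝ)), tsum_nonneg hnn, fun s h => ?_⟩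
  refine (Finset.sum_le_sum fun p hp => ?_).trans (hs.sum_le_tsum s fun n _ => hnn n)
  have hp2 : (2 : ℝ) ≤ p := by exact_mod_cast h p hp
  have hp0 : (0 : ℝ) < p := by linarith
  have hlog : Real.log p ≤ 2 * (p : ℝ) ^ (1 / 2 : ℝ) := by
    have := Real.log_le_rpow_div hp0.le (by norm_num : (0 : ℝ) < 1 / 2)
    linarith
  have h32 : (p : ℝ) ^ (3 / 2 : ℝ) * (p : ℝ) ^ (1 / 2 : ℝ) = (p : ℝ) ^ 2 := by
    rw [← Real.rpow_add hp0]; norm_num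
  have hpos : (0 : ℝ) < (p : ℝ) ^ (3 / 2 : ℝ) := by positivity
  have h1 : 0 < (p : ℝ) * (p - 1) := by nlinarith
  rw [div_le_iff₀ h1]
  calc Real.log p ≤ 2 * (p : ℝ) ^ (1 / 2 : ℝ) := hlog
    _ = 4 * (1 / (p : ℝ) ^ (3 / 2 : ℝ)) * ((p : ℝ) ^ 2 / 2) := by
        rw [← h32]; field_simp; norm_num
    _ ≤ _ := by
        refine mul_le_mul_of_nonneg_left ?_ (hnn p)
        nlinarith

/-- Mertens' first theorem. -/
theorem exists_abs_sum_logDivPrime_sub_log_le : ∃ C : ℝ, 0 ≤ C ∧ ∀ n : ℕ, 1 ≤ n →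
    |∑ p ∈ Finset.Ioc 0 n, logDivPrime p - Real.log n| ≤ C := by
  obtain ⟨c, hc0, hc⟩ := sum_log_div_mul_pred_le_const
  refine ⟨Real.log 4 + 1 + c, by positivity, fun n hn => ?_⟩
  have hn0 : (0 : ℝ) < n := by exact_mod_cast hn
  set s := (Finset.Ioc 0 n).filter Nat.Prime with hs
  have hsum : ∑ p ∈ Finset.Ioc 0 n, logDivPrime p = ∑ p ∈ s, Real.log p / p := by
    rw [hs, Finset.sum_filter]; rfl
  have hup : Real.log (n.factorial : ℝ) ≤ n * Real.log n := by
    rw [← Real.log_pow]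
    exact Real.log_le_log (by positivity) (by exact_mod_cast Nat.factorial_le_pow n)
  have hlo : n * Real.log n - n ≤ Real.log (n.factorial : ℝ) := by
    have h := Real.pow_div_factorial_le_exp (n : ℝ) hn0.le n
    have h2 := Real.log_le_log (by positivity) h
    rw [Real.log_exp, Real.log_div (by positivity) (by positivity), Real.log_pow] at h2
    linarith
  rw [log_factorial_eq_sum_padicValNat] at hup hlo
  have hprime : ∀ p ∈ s, p.Prime := fun p hp => (Finset.mem_filter.1 hp).2
  -- Rounding in Legendre's formula loses at most $\theta(n)$, which Chebyshev's bound makes $O(n)$.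
  have h1 : n * (∑ p ∈ s, Real.log p / p) - Real.log 4 * n ≤
      ∑ p ∈ s, (padicValNat p n.factorial : ℝ) * Real.log p := by
    have ht : ∑ p ∈ s, Real.log p ≤ Real.log 4 * n := by
      have := Chebyshev.theta_le_log4_mul_x hn0.le
      rwa [Chebyshev.theta, Nat.floor_natCast] at this
    have : n * (∑ p ∈ s, Real.log p / p) - ∑ p ∈ s, Real.log p ≤
        ∑ p ∈ s, (padicValNat p n.factorial : ℝ) * Real.log p := by
      rw [Finset.mul_sum, ← Finset.sum_sub_distrib]
      refine Finset.sum_le_sum fun p hp => ?_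
      have := mul_le_mul_of_nonneg_right (div_sub_one_le_padicValNat_factorial (hprime p hp) n)
        (Real.log_natCast_nonneg p)
      calc _ = ((n : ℝ) / p - 1) * Real.log p := by ring
        _ ≤ _ := this
    linarith
  have h2 : ∑ p ∈ s, (padicValNat p n.factorial : ℝ) * Real.log p ≤
      n * (∑ p ∈ s, Real.log p / p) + n * c := by
    have h3 := mul_le_mul_of_nonneg_left (hc s fun p hp => (hprime p hp).two_le) hn0.le
    refine le_trans ?_ (add_le_add_right h3 _)
    rw [Finset.mul_sum, Finset.mul_sum, ← Finset.sum_add_distrib]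
    refine Finset.sum_le_sum fun p hp => ?_
    have hp1 : (1 : ℝ) < p := by exact_mod_cast (hprime p hp).one_lt
    refine (mul_le_mul_of_nonneg_right (padicValNat_factorial_le_div (hprime p hp) n)
      (Real.log_natCast_nonneg p)).trans (le_of_eq ?_)
    have : (p : ℝ) - 1 ≠ 0 := by linarith
    field_simp
    ring
  rw [hsum, abs_le]
  constructor
  · have : 0 ≤ n * ((∑ p ∈ s, Real.log p / p) - Real.log n + (1 + c)) := by nlinarith
    have := nonneg_of_mul_nonneg_right this hn0
    have := Real.log_nonneg (by norm_num : (1 : ℝ) ≤ 4)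
    linarith
  · have : 0 ≤ n * (Real.log n - (∑ p ∈ s, Real.log p / p) + Real.log 4) := by nlinarith
    have := nonneg_of_mul_nonneg_right this hn0
    linarith

theorem exists_le_sum_logDivPrime_Ioc : ∃ C : ℝ, 0 ≤ C ∧ ∀ y z : ℝ, 1 ≤ y → y ≤ z →
    Real.log z - Real.log y - C ≤ ∑ p ∈ Finset.Ioc ⌊y⌋₊ ⌊z⌋₊, logDivPrime p := by
  obtain ⟨C, hC0, hC⟩ := exists_abs_sum_logDivPrime_sub_log_le
  refine ⟨2 * C + Real.log 2, by positivity, fun y z hy hyz => ?_⟩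
  have hfy : 1 ≤ ⌊y⌋₊ := (Nat.one_le_floor_iff y).2 hy
  have hfz : 1 ≤ ⌊z⌋₊ := (Nat.one_le_floor_iff z).2 (hy.trans hyz)
  have h1 := (abs_le.1 (hC _ hfy)).2
  have h2 := (abs_le.1 (hC _ hfz)).1
  have hsplit := Finset.sum_Ioc_consecutive logDivPrime (Nat.zero_le ⌊y⌋₊) (Nat.floor_mono hyz)
  have h3 : Real.log ⌊y⌋₊ ≤ Real.log y :=
    Real.log_le_log (by exact_mod_cast hfy) (Nat.floor_le (by linarith))
  have h4 : Real.log z ≤ Real.log 2 + Real.log ⌊z⌋₊ := by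
    rw [← Real.log_mul (by norm_num) (by positivity)]
    refine Real.log_le_log (by linarith) ?_
    have := (Nat.lt_floor_add_one z).le
    have : (1 : ℝ) ≤ ⌊z⌋₊ := by exact_mod_cast hfz
    linarith
  linarith

theorem div_sq_le_sum_primes_inv_mul_log {s t : ℕ} {B : ℝ} (hB : 0 < B)
    (ht : ∀ n ∈ Finset.Ioc s t, Real.log n ≤ B) :
    (∑ p ∈ Finset.Ioc s t, logDivPrime p) / B ^ 2 ≤
      ∑ p ∈ Finset.Ioc s t, if p.Prime then 1 / ((p : ℝ) * Real.log p) else 0 := by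
  rw [Finset.sum_div]
  refine Finset.sum_le_sum fun p hp => ?_
  unfold logDivPrime
  split_ifs with h
  · have hp0 : (0 : ℝ) < p := by exact_mod_cast h.pos
    have hl : 0 < Real.log p := Real.log_pos (by exact_mod_cast h.one_lt)
    have := ht p hp
    rw [div_div, div_le_div_iff₀ (by positivity) (by positivity)]
    have h2 : Real.log p ^ 2 ≤ B ^ 2 := pow_le_pow_left₀ hl.le this 2
    nlinarith
  · simp

/-- The range is cut at the points $y^{\beta^k}$. On a block $\log p$ varies by a factor at most
$\beta$, so Mertens divided by the square of the largest logarithm loses little, and the block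
bounds telescope. The hypothesis on $\log y$ lets the Mertens error be a fraction $\delta$ of even
the first block. -/
theorem sum_primes_inv_mul_log_ge_of_geometric {C β δ y : ℝ} (hC : 0 ≤ C) (hβ : 1 < β)
    (hy : 1 < y) (hlog : C ≤ δ * ((β - 1) * Real.log y))
    (h : ∀ y z : ℝ, 1 ≤ y → y ≤ z →
      Real.log z - Real.log y - C ≤ ∑ p ∈ Finset.Ioc ⌊y⌋₊ ⌊z⌋₊, logDivPrime p) (k : ℕ) :
    (1 - δ) / β * (1 - (β⁻¹) ^ k) / Real.log y ≤
      ∑ p ∈ Finset.Ioc ⌊y⌋₊ ⌊y ^ (β ^ k)⌋₊,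
        if p.Prime then 1 / ((p : ℝ) * Real.log p) else 0 := by
  have hy0 : 0 < y := by linarith
  have hl : 0 < Real.log y := Real.log_pos hy
  induction k with
  | zero => simp
  | succ k ih =>
    have hbk : 1 ≤ β ^ k := one_le_pow₀ hβ.le
    have hbk1 : β ^ k ≤ β ^ (k + 1) := pow_le_pow_right₀ hβ.le (Nat.le_succ k)
    have hyk : y ≤ y ^ (β ^ k) := by
      simpa using Real.rpow_le_rpow_of_exponent_le hy.le hbk
    have hykk : y ^ (β ^ k) ≤ y ^ (β ^ (k + 1)) := Real.rpow_le_rpow_of_exponent_le hy.le hbk1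
    rw [← Finset.sum_Ioc_consecutive _ (Nat.floor_mono hyk) (Nat.floor_mono hykk)]
    have hblock := div_sq_le_sum_primes_inv_mul_log (s := ⌊y ^ (β ^ k)⌋₊)
      (t := ⌊y ^ (β ^ (k + 1))⌋₊) (B := β ^ (k + 1) * Real.log y) (by positivity) (fun n hn => by
        have hn' := Finset.mem_Ioc.1 hn
        rw [← Real.log_rpow hy0]
        refine Real.log_le_log (by exact_mod_cast (Nat.zero_le _).trans_lt hn'.1) ?_
        exact (Nat.le_floor_iff (by positivity)).1 hn'.2)
    have hm := h _ _ (hy.le.trans hyk) hykk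
    rw [Real.log_rpow hy0, Real.log_rpow hy0] at hm
    have hm2 : (1 - δ) * ((β - 1) * β ^ k * Real.log y) ≤
        β ^ (k + 1) * Real.log y - β ^ k * Real.log y - C := by
      have h1 : C ≤ β ^ k * (δ * ((β - 1) * Real.log y)) :=
        hlog.trans (le_mul_of_one_le_left (hC.trans hlog) hbk)
      rw [pow_succ]
      linarith
    have hfin : (1 - δ) / β * ((β⁻¹) ^ k - (β⁻¹) ^ (k + 1)) / Real.log y =
        (1 - δ) * ((β - 1) * β ^ k * Real.log y) / (β ^ (k + 1) * Real.log y) ^ 2 := by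
      have : β ≠ 0 := by positivity
      rw [inv_pow, inv_pow, pow_succ]
      field_simp
    have h4 : (1 - δ) / β * ((β⁻¹) ^ k - (β⁻¹) ^ (k + 1)) / Real.log y ≤ _ :=
      hfin.le.trans ((div_le_div_of_nonneg_right (hm2.trans hm) (by positivity)).trans hblock)
    have h5 : (1 - δ) / β * (1 - (β⁻¹) ^ (k + 1)) / Real.log y =
      (1 - δ) / β * (1 - (β⁻¹) ^ k) / Real.log y +
        (1 - δ) / β * ((β⁻¹) ^ k - (β⁻¹) ^ (k + 1)) / Real.log y := by ring
    rw [h5]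
    exact add_le_add ih h4

theorem exists_le_sum_primes_inv_mul_log {δ : ℝ} (hδ : 0 < δ) : ∃ A : ℝ, 1 ≤ A ∧ ∃ Y : ℝ, 1 < Y ∧
    ∀ y : ℝ, Y ≤ y → (1 - δ) / Real.log y ≤
      ∑ p ∈ Finset.Ioc ⌊y⌋₊ ⌊y ^ A⌋₊, if p.Prime then 1 / ((p : ℝ) * Real.log p) else 0 := by
  obtain ⟨C, hC, hM⟩ := exists_le_sum_logDivPrime_Ioc
  -- One small $t$ serves three times: $\beta=1+t$, relative Mertens error $t$, and $\beta^{-k}<t$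
  -- for the missing tail.
  have hcont : Filter.Tendsto (fun t : ℝ => (1 - t) / (1 + t) * (1 - t))
      (nhdsWithin 0 (Set.Ioi 0)) (nhds ((1 - 0) / (1 + 0) * (1 - 0))) := by
    refine Filter.Tendsto.mono_left (ContinuousAt.tendsto ?_) nhdsWithin_le_nhds
    exact ContinuousAt.mul (ContinuousAt.div (by fun_prop) (by fun_prop) (by norm_num)) (by fun_prop)
  have hev := hcont.eventually (lt_mem_nhds (show 1 - δ < (1 - 0) / (1 + 0) * (1 - 0) by
    norm_num; exact hδ))
  obtain ⟨t, ht, ht0, ht1⟩ :=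
    (hev.and (Ioo_mem_nhdsGT (show (0 : ℝ) < 1 by norm_num))).exists
  have hβ : 1 < 1 + t := by linarith
  obtain ⟨k, hk⟩ := exists_pow_lt_of_lt_one ht0 (inv_lt_one_of_one_lt₀ hβ)
  refine ⟨(1 + t) ^ k, one_le_pow₀ hβ.le, Real.exp (C / (t * t) + 1),
    Real.one_lt_exp_iff.2 (by positivity), fun y hy => ?_⟩
  have hy1 : 1 < y := (Real.one_lt_exp_iff.2 (by positivity)).trans_le hy
  have hlog : C / (t * t) + 1 ≤ Real.log y := (Real.le_log_iff_exp_le (by linarith)).2 hy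
  refine le_trans ?_ (sum_primes_inv_mul_log_ge_of_geometric (δ := t) hC hβ hy1 ?_ hM k)
  · refine div_le_div_of_nonneg_right (ht.le.trans ?_) (by linarith [Real.log_pos hy1])
    refine mul_le_mul_of_nonneg_left (by linarith) (div_nonneg (by linarith) (by linarith))
  · have h1 : C / (t * t) ≤ Real.log y := by linarith
    rw [div_le_iff₀ (by positivity)] at h1
    calc C ≤ _ := h1
      _ = _ := by ring

/-! ### Construction of the resonator -/

/-- The function supported on squarefree numbers which is multiplicative with values `f p` at the
primes. -/
noncomputable def squarefreeExt (f : ℕ → ℝ) (n : ℕ) : ℝ :=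
  if Squarefree n then ∏ p ∈ n.primeFactors, f p else 0

theorem squarefreeExt_nonneg {f : ℕ → ℝ} (hf : ∀ p, 0 ≤ f p) (n : ℕ) : 0 ≤ squarefreeExt f n := by
  unfold squarefreeExt
  split_ifs
  · exact Finset.prod_nonneg fun p _ => hf p
  · exact le_rfl

theorem squarefree_prod_primes {T : Finset ℕ} (hT : ∀ p ∈ T, p.Prime) :
    Squarefree (∏ p ∈ T, p) := by
  refine Finset.squarefree_prod_of_pairwise_isCoprime (fun p hp q hq hpq => ?_)
    fun p hp => (hT p hp).squarefree
  exact Nat.coprime_iff_isRelPrime.1 ((Nat.coprime_primes (hT p hp) (hT q hq)).2 hpq)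

theorem squarefreeExt_prod_primes (f : ℕ → ℝ) {T : Finset ℕ} (hT : ∀ p ∈ T, p.Prime) :
    squarefreeExt f (∏ p ∈ T, p) = ∏ p ∈ T, f p := by
  rw [squarefreeExt, if_pos (squarefree_prod_primes hT), Nat.primeFactors_prod hT]

theorem injOn_prod_primes {P : Finset ℕ} (hP : ∀ p ∈ P, p.Prime) :
    Set.InjOn (fun T : Finset ℕ => ∏ p ∈ T, p) (P.powerset : Set (Finset ℕ)) := by
  intro S hS T hT h
  have hS' := Finset.mem_powerset.1 (Finset.mem_coe.1 hS)
  have hT' := Finset.mem_powerset.1 (Finset.mem_coe.1 hT)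
  rw [← Nat.primeFactors_prod fun p hp => hP p (hS' hp),
    ← Nat.primeFactors_prod fun p hp => hP p (hT' hp)]
  exact congrArg Nat.primeFactors h

theorem sum_Icc_squarefreeExt_mul {P : Finset ℕ} (hP : ∀ p ∈ P, p.Prime) {f : ℕ → ℝ}
    (hf : ∀ p ∉ P, f p = 0) (g : ℕ → ℝ) (N : ℕ) :
    ∑ n ∈ Finset.Icc 1 N, squarefreeExt f n * g n =
      ∑ T ∈ P.powerset with ∏ p ∈ T, p ≤ N, (∏ p ∈ T, f p) * g (∏ p ∈ T, p) := by
  have hsub : ∀ T ∈ P.powerset.filter (fun T => ∏ p ∈ T, p ≤ N), ∀ p ∈ T, p.Prime :=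
    fun T hT p hp => hP p (Finset.mem_powerset.1 (Finset.mem_filter.1 hT).1 hp)
  have h1 : ∑ T ∈ P.powerset with ∏ p ∈ T, p ≤ N, (∏ p ∈ T, f p) * g (∏ p ∈ T, p) =
      ∑ n ∈ (P.powerset.filter (fun T => ∏ p ∈ T, p ≤ N)).image (fun T => ∏ p ∈ T, p),
        squarefreeExt f n * g n := by
    rw [Finset.sum_image]
    · exact Finset.sum_congr rfl fun T hT => by rw [squarefreeExt_prod_primes f (hsub T hT)]
    · exact (injOn_prod_primes hP).mono fun T hT =>
        Finset.mem_coe.2 (Finset.mem_filter.1 (Finset.mem_coe.1 hT)).1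
  rw [h1]
  refine (Finset.sum_subset (fun n hn => ?_) fun n hn hn' => ?_).symm
  · obtain ⟨T, hT, rfl⟩ := Finset.mem_image.1 hn
    exact Finset.mem_Icc.2 ⟨Finset.prod_pos fun p hp => (hsub T hT p hp).pos,
      (Finset.mem_filter.1 hT).2⟩
  · by_contra hne
    apply hn'
    have hne' := left_ne_zero_of_mul hne
    unfold squarefreeExt at hne'
    split_ifs at hne' with hs
    · have hprod := Nat.prod_primeFactors_of_squarefree hs
      refine Finset.mem_image.2 ⟨n.primeFactors, Finset.mem_filter.2
        ⟨Finset.mem_powerset.2 fun p hp => ?_, ?_⟩, hprod⟩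
      · by_contra hpP
        exact hne' (Finset.prod_eq_zero hp (hf p hpP))
      · rw [hprod]; exact (Finset.mem_Icc.1 hn).2
    · exact (hne' rfl).elim

/-- Expanding the product gives one term for each subset of $T$, that is, for each divisor $m$ of
the squarefree number $\prod_{p\in T}p$. -/
theorem prod_add_inv_sqrt_le_sum_divisors {f : ℕ → ℝ} (hf : ∀ p, 0 ≤ f p) {T : Finset ℕ}
    (hT : ∀ p ∈ T, p.Prime) :
    ∏ p ∈ T, (f p + 1 / Real.sqrt p) ≤
      ∑ m ∈ (∏ p ∈ T, p).divisors, squarefreeExt f m / Real.sqrt ((∏ p ∈ T, p : ℕ) / m : ℝ) := by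
  have hpos : ∏ p ∈ T, p ≠ 0 := Finset.prod_ne_zero_iff.2 fun p hp => (hT p hp).ne_zero
  rw [Finset.prod_add]
  have hsub : ∀ S ∈ T.powerset, ∀ p ∈ S, p.Prime :=
    fun S hS p hp => hT p (Finset.mem_powerset.1 hS hp)
  have h1 : ∑ S ∈ T.powerset, (∏ p ∈ S, f p) * ∏ p ∈ T \ S, (1 / Real.sqrt p) =
      ∑ m ∈ T.powerset.image (fun S => ∏ p ∈ S, p),
        squarefreeExt f m / Real.sqrt ((∏ p ∈ T, p : ℕ) / m : ℝ) := by
    rw [Finset.sum_image (injOn_prod_primes hT)]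
    refine Finset.sum_congr rfl fun S hS => ?_
    rw [squarefreeExt_prod_primes f (hsub S hS), div_eq_mul_one_div]
    congr 1
    have hS0 : ((∏ p ∈ S, p : ℕ) : ℝ) ≠ 0 := by
      exact_mod_cast Finset.prod_ne_zero_iff.2 fun p hp => (hsub S hS p hp).ne_zero
    rw [← Finset.prod_sdiff (Finset.mem_powerset.1 hS), Nat.cast_mul, mul_div_assoc,
      div_self hS0, mul_one, Nat.cast_prod, Real.sqrt_eq_rpow,
      ← Real.finsetProd_rpow _ _ fun p _ => Nat.cast_nonneg p, Finset.prod_div_distrib,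
      Finset.prod_const_one]
    simp only [Real.sqrt_eq_rpow]
  rw [h1]
  refine Finset.sum_le_sum_of_subset_of_nonneg (fun m hm => ?_) fun m _ _ => ?_
  · obtain ⟨S, hS, rfl⟩ := Finset.mem_image.1 hm
    exact Nat.mem_divisors.2 ⟨Finset.prod_dvd_prod_of_subset _ _ _ (Finset.mem_powerset.1 hS), hpos⟩
  · exact div_nonneg (squarefreeExt_nonneg hf m) (Real.sqrt_nonneg _)

/-- This turns the quadratic form of the resonance method into a truncated Euler product with local
weights $f(p)^2+f(p)/\sqrt p$, ready for Rankin's trick. -/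
theorem sum_prod_le_sum_sum_divisors {P : Finset ℕ} (hP : ∀ p ∈ P, p.Prime) {f : ℕ → ℝ}
    (hf0 : ∀ p, 0 ≤ f p) (hf : ∀ p ∉ P, f p = 0) (N : ℕ) :
    ∑ T ∈ P.powerset with ∏ p ∈ T, p ≤ N, ∏ p ∈ T, (f p ^ 2 + f p / Real.sqrt p) ≤
      ∑ n ∈ Finset.Icc 1 N, ∑ m ∈ n.divisors,
        squarefreeExt f m * squarefreeExt f n / Real.sqrt (n / m : ℝ) := by
  have h : ∀ n : ℕ, ∑ m ∈ n.divisors,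
        squarefreeExt f m * squarefreeExt f n / Real.sqrt (n / m : ℝ) =
      squarefreeExt f n * ∑ m ∈ n.divisors, squarefreeExt f m / Real.sqrt (n / m : ℝ) := fun n => by
    rw [Finset.mul_sum]
    exact Finset.sum_congr rfl fun m _ => by ring
  simp only [h]
  rw [sum_Icc_squarefreeExt_mul hP hf]
  refine Finset.sum_le_sum fun T hT => ?_
  have hT' : ∀ p ∈ T, p.Prime :=
    fun p hp => hP p (Finset.mem_powerset.1 (Finset.mem_filter.1 hT).1 hp)
  refine le_trans (le_of_eq ?_) (mul_le_mul_of_nonneg_left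
    (prod_add_inv_sqrt_le_sum_divisors hf0 hT') (Finset.prod_nonneg fun p _ => hf0 p))
  rw [← Finset.prod_mul_distrib]
  exact Finset.prod_congr rfl fun p _ => by ring

theorem sum_squarefreeExt_sq_le {P : Finset ℕ} (hP : ∀ p ∈ P, p.Prime) {f : ℕ → ℝ}
    (hf : ∀ p ∉ P, f p = 0) (N : ℕ) :
    ∑ n ∈ Finset.Icc 1 N, squarefreeExt f n ^ 2 ≤ ∏ p ∈ P, (1 + f p ^ 2) := by
  simp only [pow_two]
  rw [sum_Icc_squarefreeExt_mul hP hf, Finset.prod_one_add]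
  refine (Finset.sum_congr rfl fun T hT => ?_).trans_le
    (Finset.sum_le_sum_of_subset_of_nonneg (Finset.filter_subset _ _) fun T _ _ =>
      Finset.prod_nonneg fun p _ => mul_self_nonneg (f p))
  rw [squarefreeExt_prod_primes, Finset.prod_mul_distrib]
  exact fun p hp => hP p (Finset.mem_powerset.1 (Finset.mem_filter.1 hT).1 hp)

/-- Rankin's trick for truncated products over sets of primes. -/
theorem prod_one_add_sub_le_sum_truncated {P : Finset ℕ} {w : ℕ → ℝ}
    (hw : ∀ p, 0 ≤ w p) {N : ℝ} (hN0 : 0 < N) {α : ℝ} (hα : 0 ≤ α) :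
    ∏ p ∈ P, (1 + w p) - N ^ (-α) * ∏ p ∈ P, (1 + w p * (p : ℝ) ^ α) ≤
      ∑ T ∈ P.powerset with ∏ p ∈ T, p ≤ ⌊N⌋₊, ∏ p ∈ T, w p := by
  rw [Finset.prod_one_add, Finset.prod_one_add, ← Finset.sum_filter_add_sum_filter_not P.powerset
    (fun T => ∏ p ∈ T, p ≤ ⌊N⌋₊), add_sub_assoc, Finset.mul_sum]
  have : ∑ T ∈ P.powerset with ¬ ∏ p ∈ T, p ≤ ⌊N⌋₊, ∏ p ∈ T, w p ≤
      ∑ T ∈ P.powerset, N ^ (-α) * ∏ p ∈ T, w p * (p : ℝ) ^ α := by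
    refine (Finset.sum_le_sum fun T hT => ?_).trans
      (Finset.sum_le_sum_of_subset_of_nonneg (Finset.filter_subset _ _) fun T _ _ =>
        mul_nonneg (Real.rpow_nonneg hN0.le _) (Finset.prod_nonneg fun p _ =>
          mul_nonneg (hw p) (Real.rpow_nonneg p.cast_nonneg _)))
    have hlt := not_le.1 (Finset.mem_filter.1 hT).2
    rw [Finset.prod_mul_distrib, Real.finsetProd_rpow _ _ fun p _ => Nat.cast_nonneg p,
      mul_left_comm]
    refine le_mul_of_one_le_right (Finset.prod_nonneg fun p _ => hw p) ?_
    rw [Real.rpow_neg hN0.le, ← div_eq_inv_mul, one_le_div (by positivity)]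
    refine Real.rpow_le_rpow hN0.le ?_ hα
    rw [← Nat.cast_prod]
    exact (Nat.lt_of_floor_lt hlt).le
  linarith

/-- The logarithm of $(1+a^2+b)/(1+a^2)$ is at least $b/(1+a^2+b)\ge b/(1+\delta)\ge(1-\delta)b$.
With $a=f(p)$ and $b=f(p)/\sqrt p$ it is the gain at one prime. -/
theorem exp_mul_one_add_sq_le {δ a b : ℝ} (hb : 0 ≤ b) (h : a ^ 2 + b ≤ δ) :
    Real.exp ((1 - δ) * b) * (1 + a ^ 2) ≤ 1 + (a ^ 2 + b) := by
  have h1 : 0 < 1 + a ^ 2 := by positivity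
  have h2 : 0 < 1 + (a ^ 2 + b) := by positivity
  rw [← le_div_iff₀ h1, ← Real.le_log_iff_exp_le (by positivity)]
  refine le_trans ?_ (Real.one_sub_inv_le_log_of_pos (by positivity))
  rw [inv_div]
  have h3 : 1 - (1 + a ^ 2) / (1 + (a ^ 2 + b)) = b / (1 + (a ^ 2 + b)) := by field_simp; ring
  rw [h3, le_div_iff₀ h2]
  nlinarith [mul_nonneg hb (sq_nonneg a), mul_nonneg hb hb,
    mul_nonneg hb (sub_nonneg.2 h), mul_nonneg (add_nonneg (sq_nonneg a) hb) (mul_nonneg hb (sub_nonneg.2 h)),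
    mul_nonneg hb (mul_nonneg (add_nonneg (sq_nonneg a) hb) (add_nonneg (sq_nonneg a) hb))]

theorem one_add_mul_rpow_le {w α κ : ℝ} {p : ℕ} (hw : 0 ≤ w) (hp : 1 ≤ p) (hα : 0 ≤ α)
    (hκ : α * Real.log p ≤ κ) :
    1 + w * (p : ℝ) ^ α ≤ Real.exp (α * Real.exp κ * (w * Real.log p)) * (1 + w) := by
  have hp0 : (0 : ℝ) < p := by exact_mod_cast hp
  have ht : 0 ≤ α * Real.log p := mul_nonneg hα (Real.log_natCast_nonneg p)
  have hexp : (p : ℝ) ^ α - 1 ≤ α * Real.log p * Real.exp κ := by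
    rw [Real.rpow_def_of_pos hp0, mul_comm (Real.log _)]
    set t := α * Real.log p
    have h1 : Real.exp t - 1 ≤ t * Real.exp t := by
      have h := Real.add_one_le_exp (-t)
      have h2 : Real.exp t * Real.exp (-t) = 1 := by rw [← Real.exp_add]; simp
      nlinarith [Real.exp_pos t]
    exact h1.trans (mul_le_mul_of_nonneg_left (Real.exp_le_exp.2 hκ) ht)
  have h1 : 0 ≤ α * Real.exp κ * (w * Real.log p) := by
    have := Real.log_natCast_nonneg p
    positivity
  have h2 := Real.add_one_le_exp (α * Real.exp κ * (w * Real.log p))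
  have h3 : w * ((p : ℝ) ^ α - 1) ≤ α * Real.exp κ * (w * Real.log p) := by
    calc _ ≤ w * (α * Real.log p * Real.exp κ) := mul_le_mul_of_nonneg_left hexp hw
      _ = _ := by ring
  nlinarith

/-- The full Euler product gains $\exp((1-\delta)LS)$ over $\prod(1+f(p)^2)$. The normalization
$L^2S=(1-\delta)X$ puts the typical $\log n$ below $\log N=X$, so truncation at $N$ costs at most a
factor 2, the $\log2$ in the exponent. -/
theorem resonator_of_bounds {P : Finset ℕ} (hP : ∀ p ∈ P, p.Prime) {δ κ A X N L S : ℝ}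
    (hδ : 0 < δ) (hδ1 : δ < 1) (hκ : 0 < κ) (hκδ : Real.exp κ = 1 + δ) (hA : 1 ≤ A)
    (hN : 0 < N) (hX : Real.log N = X) (hX1 : 1 < X) (hlX : 1 ≤ Real.log X) (hPX : ∀ p ∈ P, X ≤ p)
    (hPA : ∀ p ∈ P, Real.log p ≤ A * Real.log X) (hL : 0 < L)
    (hS : S = ∑ p ∈ P, 1 / ((p : ℝ) * Real.log p)) (hLS : L ^ 2 * S = (1 - δ) * X)
    (hL2 : L ^ 2 ≤ X * Real.log X) (hsmall : 2 / Real.sqrt (Real.log X) ≤ δ)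
    (hE : L * ∑ p ∈ P, 1 / (p : ℝ) ≤ δ ^ 2 / 4 * X)
    (htail : Real.log 2 ≤ κ * X * δ ^ 2 / (2 * (A * Real.log X))) :
    ∃ r : ℕ → ℝ, (∀ n, 0 ≤ r n) ∧ 0 < ∑ n ∈ Finset.Icc 1 ⌊N⌋₊, r n ^ 2 ∧
      Real.exp ((1 - δ) * (L * S) - Real.log 2) * ∑ n ∈ Finset.Icc 1 ⌊N⌋₊, r n ^ 2 ≤
        ∑ n ∈ Finset.Icc 1 ⌊N⌋₊, ∑ m ∈ n.divisors, r m * r n / Real.sqrt (n / m : ℝ) := by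
  classical
  set l := Real.log X with hl
  have hN1 : 1 ≤ N := by
    by_contra h
    linarith [Real.log_nonpos hN.le (not_le.1 h).le]
  have hl0 : 0 < l := by linarith
  -- With this choice $f(p)^2\log p=L^2/(p\log p)$ and $f(p)/\sqrt p=L/(p\log p)$, so the length
  -- constraint and the gain involve the same sum $S$.
  set f : ℕ → ℝ := fun p => if p ∈ P then L / (Real.sqrt p * Real.log p) else 0 with hf
  have hf0 : ∀ p, 0 ≤ f p := fun p => by
    simp only [hf]
    split_ifs
    · exact div_nonneg hL.le (mul_nonneg (Real.sqrt_nonneg _) (Real.log_natCast_nonneg p))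
    · exact le_rfl
  have hfP : ∀ p ∉ P, f p = 0 := fun p hp => if_neg hp
  have hfeq : ∀ p ∈ P, f p = L / (Real.sqrt p * Real.log p) := fun p hp => if_pos hp
  have hp1 : ∀ p ∈ P, (1 : ℝ) < p := fun p hp => by exact_mod_cast (hP p hp).one_lt
  have hlp : ∀ p ∈ P, l ≤ Real.log p := fun p hp => Real.log_le_log (by linarith) (hPX p hp)
  have hfsq : ∀ p ∈ P, f p ^ 2 = L ^ 2 / (p * Real.log p ^ 2) := fun p hp => by
    rw [hfeq p hp, div_pow, mul_pow, Real.sq_sqrt (Nat.cast_nonneg p)]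
  have hfdiv : ∀ p ∈ P, f p / Real.sqrt p = L * (1 / (p * Real.log p)) := fun p hp => by
    have hs := Real.mul_self_sqrt (Nat.cast_nonneg (α := ℝ) p)
    have : Real.sqrt p ≠ 0 := (Real.sqrt_pos.2 (by linarith [hp1 p hp])).ne'
    have h2 : Real.log p ≠ 0 := by linarith [hlp p hp]
    rw [hfeq p hp, ← hs]
    simp only [Real.sqrt_mul_self (Real.sqrt_nonneg _)]
    field_simp
  have hfsq_le : ∀ p ∈ P, f p ^ 2 ≤ 1 / l := fun p hp => by
    rw [hfsq p hp, div_le_div_iff₀ (mul_pos (by linarith [hp1 p hp])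
      (pow_pos (hl0.trans_le (hlp p hp)) 2)) hl0, one_mul]
    have h1 : l ^ 2 ≤ Real.log p ^ 2 := pow_le_pow_left₀ hl0.le (hlp p hp) 2
    calc L ^ 2 * l ≤ X * l * l := mul_le_mul_of_nonneg_right hL2 hl0.le
      _ = X * l ^ 2 := by ring
      _ ≤ p * Real.log p ^ 2 := mul_le_mul (hPX p hp) h1 (by positivity) (by linarith [hp1 p hp])
  have hsl : 1 ≤ Real.sqrt l := Real.one_le_sqrt.2 hlX
  have hf_le : ∀ p ∈ P, f p ≤ 1 / Real.sqrt l := fun p hp => by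
    refine (sq_le_sq₀ (hf0 p) (by positivity)).1 ?_
    rw [div_pow, one_pow, Real.sq_sqrt hl0.le]
    exact hfsq_le p hp
  have hw_le : ∀ p ∈ P, f p ^ 2 + f p / Real.sqrt p ≤ δ := fun p hp => by
    have h1 : f p / Real.sqrt p ≤ f p :=
      div_le_self (hf0 p) (Real.one_le_sqrt.2 (hp1 p hp).le)
    have h2 : 1 / l ≤ 1 / Real.sqrt l := by
      refine one_div_le_one_div_of_le (by linarith) ?_
      nlinarith [Real.sq_sqrt hl0.le]
    calc _ ≤ 1 / Real.sqrt l + 1 / Real.sqrt l :=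
          add_le_add ((hfsq_le p hp).trans h2) (h1.trans (hf_le p hp))
      _ = 2 / Real.sqrt l := by ring
      _ ≤ δ := hsmall
  set w : ℕ → ℝ := fun p => f p ^ 2 + f p / Real.sqrt p with hw
  have hw0 : ∀ p, 0 ≤ w p := fun p =>
    add_nonneg (sq_nonneg _) (div_nonneg (hf0 p) (Real.sqrt_nonneg _))
  -- The Rankin exponent is chosen so that $p^\alpha\le e^\kappa=1+\delta$ for every $p\in P$.
  set α := κ / (A * l) with hα
  have hAl : 0 < A * l := by positivity
  have hα0 : 0 < α := div_pos hκ hAl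
  have hmain : Real.exp ((1 - δ) * (L * S)) * ∏ p ∈ P, (1 + f p ^ 2) ≤ ∏ p ∈ P, (1 + w p) := by
    have : (1 - δ) * (L * S) = ∑ p ∈ P, (1 - δ) * (f p / Real.sqrt p) := by
      rw [hS, Finset.mul_sum, Finset.mul_sum]
      exact Finset.sum_congr rfl fun p hp => by rw [hfdiv p hp]
    rw [this, Real.exp_sum, ← Finset.prod_mul_distrib]
    exact Finset.prod_le_prod (fun p _ => by positivity) fun p hp =>
      exp_mul_one_add_sq_le (div_nonneg (hf0 p) (Real.sqrt_nonneg _)) (hw_le p hp)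
  have hwlog : ∑ p ∈ P, w p * Real.log p ≤ (1 - δ) * X + δ ^ 2 / 4 * X := by
    rw [← hLS]
    refine le_trans (le_of_eq ?_) (add_le_add_right hE _)
    rw [hS, Finset.mul_sum, Finset.mul_sum, ← Finset.sum_add_distrib]
    refine Finset.sum_congr rfl fun p hp => ?_
    have h2 : Real.log p ≠ 0 := by linarith [hlp p hp]
    have h3 : (p : ℝ) ≠ 0 := by linarith [hp1 p hp]
    simp only [hw]
    rw [hfsq p hp, hfdiv p hp]
    field_simp
  have htail' : N ^ (-α) * ∏ p ∈ P, (1 + w p * (p : ℝ) ^ α) ≤ 1 / 2 * ∏ p ∈ P, (1 + w p) := by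
    have h1 : ∏ p ∈ P, (1 + w p * (p : ℝ) ^ α) ≤
        ∏ p ∈ P, Real.exp (α * Real.exp κ * (w p * Real.log p)) * (1 + w p) :=
      Finset.prod_le_prod (fun p _ => add_nonneg zero_le_one
        (mul_nonneg (hw0 p) (Real.rpow_nonneg p.cast_nonneg _))) fun p hp =>
        one_add_mul_rpow_le (hw0 p) (hP p hp).one_lt.le hα0.le (by
          rw [hα, div_mul_eq_mul_div, div_le_iff₀ hAl]
          exact mul_le_mul_of_nonneg_left (hPA p hp) hκ.le)
    rw [Finset.prod_mul_distrib, ← Real.exp_sum, ← Finset.mul_sum] at h1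
    refine (mul_le_mul_of_nonneg_left h1 (Real.rpow_nonneg hN.le _)).trans ?_
    rw [← mul_assoc]
    refine mul_le_mul_of_nonneg_right ?_ (Finset.prod_nonneg fun p _ => by linarith [hw0 p])
    rw [Real.rpow_def_of_pos hN, hX, ← Real.exp_add, hκδ]
    have h2 : (1 : ℝ) / 2 = Real.exp (-Real.log 2) := by
      rw [Real.exp_neg, Real.exp_log (by norm_num)]; norm_num
    rw [h2, Real.exp_le_exp]
    have h3 : Real.log 2 ≤ α * (δ ^ 2 / 2 * X) := by
      refine htail.trans (le_of_eq ?_)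
      rw [hα]; field_simp
    -- Here $(1+\delta)(1-\delta+\delta^2/4)\le1-\delta^2/2$, which leaves the saving
    -- $\alpha\delta^2X/2\ge\log2$.
    have h4 : (1 + δ) * ∑ p ∈ P, w p * Real.log p ≤ X - δ ^ 2 / 2 * X := by
      have h5 : δ ^ 2 * X * δ ≤ δ ^ 2 * X * 1 :=
        mul_le_mul_of_nonneg_left hδ1.le (by positivity)
      have := mul_le_mul_of_nonneg_left hwlog (by linarith : (0 : ℝ) ≤ 1 + δ)
      nlinarith
    have := mul_le_mul_of_nonneg_left h4 hα0.le
    nlinarith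
  have hr := prod_one_add_sub_le_sum_truncated (P := P) hw0 hN hα0.le
  have hr2 := sum_prod_le_sum_sum_divisors hP hf0 hfP ⌊N⌋₊
  have hr3 := sum_squarefreeExt_sq_le hP hfP ⌊N⌋₊
  refine ⟨squarefreeExt f, squarefreeExt_nonneg hf0, ?_, ?_⟩
  · refine Finset.sum_pos' (fun n _ => sq_nonneg _) ⟨1, Finset.mem_Icc.2 ⟨le_rfl, ?_⟩, ?_⟩
    · exact (Nat.one_le_floor_iff N).2 hN1
    · simp [squarefreeExt]
  · calc _ ≤ Real.exp ((1 - δ) * (L * S) - Real.log 2) * ∏ p ∈ P, (1 + f p ^ 2) :=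
          mul_le_mul_of_nonneg_left hr3 (Real.exp_pos _).le
      _ = 1 / 2 * (Real.exp ((1 - δ) * (L * S)) * ∏ p ∈ P, (1 + f p ^ 2)) := by
          rw [Real.exp_sub, Real.exp_log (by norm_num)]; ring
      _ ≤ 1 / 2 * ∏ p ∈ P, (1 + w p) := by linarith
      _ ≤ _ := by linarith

theorem eventually_log_pow_le_mul (n : ℕ) {c : ℝ} (hc : 0 < c) :
    ∀ᶠ x : ℝ in Filter.atTop, Real.log x ^ n ≤ c * x := by
  filter_upwards [(Real.isLittleO_pow_log_id_atTop (n := n)).bound hc,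
    Filter.eventually_ge_atTop 0] with x hx hx0
  simp only [id, Real.norm_eq_abs, abs_of_nonneg hx0] at hx
  exact (le_abs_self _).trans hx

theorem sum_one_div_primes_le {P : Finset ℕ} {B : ℝ} (hB : 1 ≤ B) (hP : ∀ p ∈ P, 1 ≤ p)
    (hPB : ∀ p ∈ P, (p : ℝ) ≤ B) : ∑ p ∈ P, 1 / (p : ℝ) ≤ 1 + Real.log B := by
  have h1 : ∑ p ∈ P, 1 / (p : ℝ) ≤ ∑ p ∈ Finset.Icc 1 ⌊B⌋₊, 1 / (p : ℝ) := by
    refine Finset.sum_le_sum_of_subset_of_nonneg (fun p hp => ?_) fun p _ _ => by positivity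
    exact Finset.mem_Icc.2 ⟨hP p hp, Nat.le_floor (hPB p hp)⟩
  have h2 := harmonic_floor_le_one_add_log B hB
  rw [harmonic_eq_sum_Icc] at h2
  push_cast at h2
  simp only [← one_div] at h2
  exact h1.trans h2

/-- Existence of a resonator of length `N` for sums of length tending to infinity. -/
theorem exists_resonator {η : ℝ} (hη : 0 < η) (hη1 : η < 1) : ∃ X₀ : ℝ, ∀ N : ℝ, 0 < N →
    X₀ ≤ Real.log N → ∃ r : ℕ → ℝ, (∀ n, 0 ≤ r n) ∧ 0 < ∑ n ∈ Finset.Icc 1 ⌊N⌋₊, r n ^ 2 ∧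
      Real.exp ((1 - η) * Real.sqrt (Real.log N / Real.log (Real.log N))) *
          ∑ n ∈ Finset.Icc 1 ⌊N⌋₊, r n ^ 2 ≤
        ∑ n ∈ Finset.Icc 1 ⌊N⌋₊, ∑ m ∈ n.divisors, r m * r n / Real.sqrt (n / m : ℝ) := by
  set δ := η / 4 with hδdef
  have hδ : 0 < δ := by positivity
  have hδ1 : δ < 1 := by linarith
  obtain ⟨A, hA, Y, hY, hS⟩ := exists_le_sum_primes_inv_mul_log hδ
  set κ := Real.log (1 + δ) with hκdef
  have hκ : 0 < κ := Real.log_pos (by linarith)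
  have hκδ : Real.exp κ = 1 + δ := Real.exp_log (by linarith)
  have hlog2 : 0 < Real.log 2 := Real.log_pos (by norm_num)
  -- These conditions give, in order: the prime sum estimate, small weights $f(p)^2+f(p)/\sqrt
  -- p\le\delta$, negligible $L\sum1/p$, the Rankin tail, and absorption of $\log2$ into $\eta$.
  have hev : ∀ᶠ X : ℝ in Filter.atTop, Y ≤ X ∧ max 1 ((2 / δ) ^ 2) ≤ Real.log X ∧
      Real.log X ^ 3 ≤ δ ^ 4 / (64 * A ^ 2) * X ∧
      Real.log X ^ 1 ≤ κ * δ ^ 2 / (2 * A * Real.log 2) * X ∧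
      Real.log X ^ 1 ≤ (η / (2 * Real.log 2)) ^ 2 * X :=
    (Filter.eventually_ge_atTop Y).and ((Real.tendsto_log_atTop.eventually_ge_atTop _).and
      ((eventually_log_pow_le_mul 3 (by positivity)).and
        ((eventually_log_pow_le_mul 1 (by positivity)).and
          (eventually_log_pow_le_mul 1 (by positivity)))))
  obtain ⟨X₀, hX₀⟩ := Filter.eventually_atTop.1 hev
  refine ⟨X₀, fun N hN hNX => ?_⟩
  obtain ⟨hYX, hlX, h3, h4, h5⟩ := hX₀ _ hNX
  set X := Real.log N with hXdef
  set l := Real.log X with hldef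
  rw [pow_one] at h4 h5
  have hl1 : 1 ≤ l := (le_max_left _ _).trans hlX
  have hl2 : (2 / δ) ^ 2 ≤ l := (le_max_right _ _).trans hlX
  have hl0 : 0 < l := by linarith
  have hX1 : 1 < X := hY.trans_le hYX
  have hX0 : 0 < X := by linarith
  set P := (Finset.Ioc ⌊X⌋₊ ⌊X ^ A⌋₊).filter Nat.Prime with hPdef
  have hPp : ∀ p ∈ P, p.Prime := fun p hp => (Finset.mem_filter.1 hp).2
  have hPX : ∀ p ∈ P, X ≤ p := fun p hp =>
    (Nat.lt_of_floor_lt (Finset.mem_Ioc.1 (Finset.mem_filter.1 hp).1).1).le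
  have hPXA : ∀ p ∈ P, (p : ℝ) ≤ X ^ A := fun p hp =>
    (Nat.le_floor_iff (by positivity)).1 (Finset.mem_Ioc.1 (Finset.mem_filter.1 hp).1).2
  set S := ∑ p ∈ P, 1 / ((p : ℝ) * Real.log p) with hSdef
  have hSge : (1 - δ) / l ≤ S := by
    rw [hSdef, hPdef, Finset.sum_filter]
    exact hS X hYX
  have hS0 : 0 < S := (div_pos (by linarith) hl0).trans_le hSge
  set L := Real.sqrt ((1 - δ) * X / S) with hLdef
  have hq : 0 < (1 - δ) * X / S := div_pos (mul_pos (by linarith) hX0) hS0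
  have hL0 : 0 < L := Real.sqrt_pos.2 hq
  have hLsq : L ^ 2 = (1 - δ) * X / S := Real.sq_sqrt hq.le
  have hLS : L ^ 2 * S = (1 - δ) * X := by rw [hLsq]; field_simp
  have hL2 : L ^ 2 ≤ X * l := by
    rw [hLsq, div_le_iff₀ hS0]
    rw [div_le_iff₀ hl0] at hSge
    nlinarith
  have hsmall : 2 / Real.sqrt l ≤ δ := by
    rw [div_le_iff₀ (Real.sqrt_pos.2 hl0), mul_comm, ← div_le_iff₀ hδ]
    exact Real.le_sqrt_of_sq_le hl2
  have hE : L * ∑ p ∈ P, 1 / (p : ℝ) ≤ δ ^ 2 / 4 * X := by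
    have h1 := sum_one_div_primes_le (B := X ^ A) (Real.one_le_rpow hX1.le (by linarith))
      (fun p hp => (hPp p hp).one_lt.le) hPXA
    rw [Real.log_rpow hX0] at h1
    have hAl : 1 ≤ A * l := one_le_mul_of_one_le_of_one_le hA hl1
    have h2 : ∑ p ∈ P, 1 / (p : ℝ) ≤ 2 * (A * l) := by linarith
    refine (mul_le_mul_of_nonneg_left h2 hL0.le).trans ?_
    refine (sq_le_sq₀ (by positivity) (by positivity)).1 ?_
    have h6 : l ^ 3 * (64 * A ^ 2) ≤ δ ^ 4 * X := by
      rw [div_mul_eq_mul_div, le_div_iff₀ (by positivity)] at h3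
      exact h3
    calc (L * (2 * (A * l))) ^ 2 = L ^ 2 * (4 * A ^ 2 * l ^ 2) := by ring
      _ ≤ X * l * (4 * A ^ 2 * l ^ 2) := mul_le_mul_of_nonneg_right hL2 (by positivity)
      _ = X / 16 * (l ^ 3 * (64 * A ^ 2)) := by ring
      _ ≤ X / 16 * (δ ^ 4 * X) := mul_le_mul_of_nonneg_left h6 (by positivity)
      _ = _ := by ring
  have htail : Real.log 2 ≤ κ * X * δ ^ 2 / (2 * (A * l)) := by
    rw [div_mul_eq_mul_div, le_div_iff₀ (by positivity)] at h4
    rw [le_div_iff₀ (by positivity)]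
    linarith
  obtain ⟨r, hr0, hr1, hr2⟩ := resonator_of_bounds hPp hδ hδ1 hκ hκδ hA hN hXdef.symm hX1 hl1 hPX
    (fun p hp => by
      rw [← Real.log_rpow hX0]
      exact Real.log_le_log (by exact_mod_cast (hPp p hp).pos) (hPXA p hp))
    hL0 hSdef hLS hL2 hsmall hE htail
  refine ⟨r, hr0, hr1, le_trans (mul_le_mul_of_nonneg_right (Real.exp_le_exp.2 ?_) hr1.le) hr2⟩
  have hLSge : (1 - δ) * Real.sqrt (X / l) ≤ L * S := by
    refine (sq_le_sq₀ (mul_nonneg (by linarith) (Real.sqrt_nonneg _)) (by positivity)).1 ?_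
    rw [mul_pow, mul_pow, Real.sq_sqrt (by positivity)]
    calc (1 - δ) ^ 2 * (X / l) = (1 - δ) * X * ((1 - δ) / l) := by ring
      _ ≤ (1 - δ) * X * S := mul_le_mul_of_nonneg_left hSge (mul_nonneg (by linarith) hX0.le)
      _ = _ := by rw [← hLS]; ring
  have hsq : Real.log 2 ≤ η / 2 * Real.sqrt (X / l) := by
    rw [← div_le_iff₀' (by positivity)]
    refine Real.le_sqrt_of_sq_le ?_
    rw [le_div_iff₀ hl0, ← le_div_iff₀' (by positivity)]
    refine h5.trans (le_of_eq ?_)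
    field_simp
  have h6 := mul_le_mul_of_nonneg_left hLSge (by linarith : 0 ≤ 1 - δ)
  have h7 : (1 - η / 2) * Real.sqrt (X / l) ≤ (1 - δ) * ((1 - δ) * Real.sqrt (X / l)) := by
    rw [← mul_assoc]
    refine mul_le_mul_of_nonneg_right ?_ (Real.sqrt_nonneg _)
    rw [hδdef]
    nlinarith [sq_nonneg η]
  linarith

/-! ### The Hurwitz zeta function at $1/2$, uniformly in its parameter -/

theorem norm_ofReal_cpow_neg_sub_le {s : ℂ} (hs : 0 < s.re) {b t : ℝ} (hb : 1 ≤ b) (hbt : b ≤ t) :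
    ‖(t : ℂ) ^ (-s) - (b : ℂ) ^ (-s)‖ ≤ ‖s‖ * b ^ (-s.re - 1) * (t - b) := by
  have hs0 : s ≠ 0 := fun h => by simp [h] at hs
  have h := (convex_Icc b t).norm_image_sub_le_of_norm_hasDerivWithin_le
    (f := fun y : ℝ => (y : ℂ) ^ (-s)) (f' := fun y : ℝ => -s * (y : ℂ) ^ (-s - 1))
    (C := ‖s‖ * b ^ (-s.re - 1)) (fun y hy => ?_) (fun y hy => ?_)
    (Set.left_mem_Icc.2 hbt) (Set.right_mem_Icc.2 hbt)
  · rwa [Real.norm_of_nonneg (sub_nonneg.2 hbt)] at h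
  · have hy0 : y ≠ 0 := by linarith [hy.1]
    exact (hasDerivAt_ofReal_cpow_const hy0 (neg_ne_zero.2 hs0)).hasDerivWithinAt
  · have hy0 : 0 < y := by linarith [hy.1]
    rw [norm_mul, norm_neg, Complex.norm_cpow_eq_rpow_re_of_pos hy0]
    refine mul_le_mul_of_nonneg_left ?_ (norm_nonneg s)
    simp only [Complex.sub_re, Complex.neg_re, Complex.one_re]
    exact Real.rpow_le_rpow_of_nonpos (by linarith) hy.1 (by linarith)

/-- The difference between `b ^ (-s)` and the integral of `t ^ (-s)` over `[b, b + 1]`. -/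
noncomputable def cpowIntegralDefect (b : ℝ) (s : ℂ) : ℂ :=
  (b : ℂ) ^ (-s) - (((b + 1 : ℝ) : ℂ) ^ (-s + 1) - (b : ℂ) ^ (-s + 1)) / (-s + 1)

theorem norm_cpowIntegralDefect_le {s : ℂ} (hs : 0 < s.re) (hs1 : s ≠ 1) {b : ℝ} (hb : 1 ≤ b) :
    ‖cpowIntegralDefect b s‖ ≤ ‖s‖ * b ^ (-s.re - 1) := by
  have hbt : b ≤ b + 1 := by linarith
  have h := (convex_Icc b (b + 1)).norm_image_sub_le_of_norm_hasDerivWithin_le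
    (f := fun y : ℝ => (y : ℂ) ^ (-s + 1) / (-s + 1) - y * (b : ℂ) ^ (-s))
    (f' := fun y : ℝ => (y : ℂ) ^ (-s) - 1 * (b : ℂ) ^ (-s))
    (C := ‖s‖ * b ^ (-s.re - 1)) (fun y hy => ?_) (fun y hy => ?_)
    (Set.left_mem_Icc.2 hbt) (Set.right_mem_Icc.2 hbt)
  · rw [show b + 1 - b = 1 by ring, norm_one, mul_one, ← norm_neg] at h
    refine le_trans (le_of_eq ?_) h
    unfold cpowIntegralDefect
    congr 1
    push_cast
    ring
  · have hy0 : y ≠ 0 := by linarith [hy.1]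
    exact ((hasDerivAt_ofReal_cpow_const' (r := -s) hy0 (fun h => hs1 (neg_injective h))).sub
      (Complex.ofRealCLM.hasDerivAt.mul_const _)).hasDerivWithinAt
  · rw [one_mul]
    refine (norm_ofReal_cpow_neg_sub_le hs hb hy.1).trans (mul_le_of_le_one_right (by positivity) ?_)
    linarith [hy.2]

theorem differentiableAt_cpowIntegralDefect {b : ℝ} (hb : 1 ≤ b) {s : ℂ} (hs : s ≠ 1) :
    DifferentiableAt ℂ (cpowIntegralDefect b) s := by
  have h0 : (b : ℂ) ≠ 0 := by exact_mod_cast (by linarith : b ≠ 0)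
  have h1 : ((b + 1 : ℝ) : ℂ) ≠ 0 := by exact_mod_cast (by linarith : b + 1 ≠ 0)
  unfold cpowIntegralDefect
  refine DifferentiableAt.sub ?_ (DifferentiableAt.div (DifferentiableAt.sub ?_ ?_) (by fun_prop) ?_)
  · exact (differentiableAt_id.neg).const_cpow (Or.inl h0)
  · exact ((differentiableAt_id.neg).add_const 1).const_cpow (Or.inl h1)
  · exact ((differentiableAt_id.neg).add_const 1).const_cpow (Or.inl h0)
  · intro h
    exact hs (by linear_combination -h)

/-- A convex open neighbourhood of `1 / 2` which avoids `1` and meets the half plane `1 < re s`. -/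
def hurwitzRegion : Set ℂ := Metric.ball (1 : ℂ) (3 / 5) ∩ {z | z.re - 1 < z.im}

theorem isOpen_hurwitzRegion : IsOpen hurwitzRegion :=
  Metric.isOpen_ball.inter
    (isOpen_lt (Complex.continuous_re.sub continuous_const) Complex.continuous_im)

theorem isPreconnected_hurwitzRegion : IsPreconnected hurwitzRegion := by
  refine ((convex_ball _ _).inter ?_).isPreconnected
  intro x hx y hy a b ha hb hab
  simp only [Set.mem_ofPred_eq, Complex.add_re, Complex.add_im, Complex.real_smul,
    Complex.re_ofReal_mul, Complex.im_ofReal_mul] at hx hy ⊢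
  rcases ha.eq_or_lt with rfl | ha'
  · have : b = 1 := by linarith
    subst this
    linarith
  · nlinarith [mul_lt_mul_of_pos_left hx ha', mul_le_mul_of_nonneg_left hy.le hb]

theorem ne_one_of_mem_hurwitzRegion {s : ℂ} (hs : s ∈ hurwitzRegion) : s ≠ 1 := by
  rintro rfl
  simpa using hs.2

theorem half_mem_hurwitzRegion : (1 / 2 : ℂ) ∈ hurwitzRegion := by
  refine ⟨?_, ?_⟩
  · rw [Metric.mem_ball, dist_eq_norm]; norm_num
  · norm_num [Set.mem_ofPred_eq]

theorem re_gt_and_norm_lt_of_mem_ball {s : ℂ} (hs : s ∈ Metric.ball (1 : ℂ) (3 / 5)) :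
    2 / 5 < s.re ∧ ‖s‖ < 2 := by
  rw [Metric.mem_ball, dist_eq_norm] at hs
  have h1 := (Complex.abs_re_le_norm (s - 1)).trans_lt hs
  rw [Complex.sub_re, Complex.one_re, abs_lt] at h1
  refine ⟨by linarith, ?_⟩
  have := norm_add_le (s - 1) 1
  rw [sub_add_cancel, norm_one] at this
  linarith

theorem norm_cpowIntegralDefect_nat_le {x : ℝ} (hx : 0 ≤ x) {s : ℂ}
    (hs : s ∈ hurwitzRegion) (n : ℕ) :
    ‖cpowIntegralDefect (n + 1 + x) s‖ ≤ 2 * (1 / ((n + 1 : ℕ) : ℝ) ^ (7 / 5 : ℝ)) := by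
  obtain ⟨h1, h2⟩ := re_gt_and_norm_lt_of_mem_ball hs.1
  have hn : (1 : ℝ) ≤ n + 1 := by linarith [n.cast_nonneg (α := ℝ)]
  have hb : 1 ≤ (n : ℝ) + 1 + x := by linarith
  refine (norm_cpowIntegralDefect_le (by linarith) (ne_one_of_mem_hurwitzRegion hs) hb).trans ?_
  refine mul_le_mul h2.le ?_ (by positivity) (by norm_num)
  rw [one_div, ← Real.rpow_neg (by positivity)]
  push_cast
  calc ((n : ℝ) + 1 + x) ^ (-s.re - 1) ≤ ((n : ℝ) + 1) ^ (-s.re - 1) :=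
        Real.rpow_le_rpow_of_nonpos (by linarith) (by linarith) (by linarith)
    _ ≤ _ := Real.rpow_le_rpow_of_exponent_le hn (by linarith)

theorem summable_one_div_succ_rpow :
    Summable fun n : ℕ => 2 * (1 / ((n + 1 : ℕ) : ℝ) ^ (7 / 5 : ℝ)) :=
  ((summable_nat_add_iff 1).2 (Real.summable_one_div_nat_rpow.2 (by norm_num))).mul_left 2

/-- The integrals of $t^{-s}$ over consecutive unit intervals telescope, and for $\Re s>1$ only the
endpoint $1+x$ survives. -/
theorem tsum_cpowIntegralDefect_of_one_lt_re {x : ℝ} (hx : x ∈ Set.Icc 0 1) {s : ℂ}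
    (hsU : s ∈ hurwitzRegion) (hs : 1 < s.re) :
    ∑' n : ℕ, cpowIntegralDefect (n + 1 + x) s =
      HurwitzZeta.hurwitzZeta x s - 1 / (x : ℂ) ^ s + ((1 + x : ℝ) : ℂ) ^ (-s + 1) / (-s + 1) := by
  have h1 := (hasSum_nat_add_iff' 1).2 (HurwitzZeta.hasSum_hurwitzZeta_of_one_lt_re hx hs)
  have hlim : Filter.Tendsto (fun n : ℕ => (((n : ℝ) + (1 + x) : ℝ) : ℂ) ^ (-s + 1) / (-s + 1))
      Filter.atTop (nhds 0) := by
    rw [← zero_div (-s + 1)]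
    refine Filter.Tendsto.div_const ?_ _
    rw [tendsto_zero_iff_norm_tendsto_zero]
    have h2 : Filter.Tendsto (fun n : ℕ => ((n : ℝ) + (1 + x)) ^ (-(s.re - 1)))
        Filter.atTop (nhds 0) :=
      (tendsto_rpow_neg_atTop (by linarith)).comp
        (Filter.tendsto_atTop_add_const_right _ _ tendsto_natCast_atTop_atTop)
    refine h2.congr fun n => ?_
    have : 0 < (n : ℝ) + (1 + x) := by linarith [n.cast_nonneg (α := ℝ), hx.1]
    rw [Complex.norm_cpow_eq_rpow_re_of_pos this]
    congr 1
    simp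
    ring
  have hsum : Summable fun n : ℕ => cpowIntegralDefect (n + 1 + x) s :=
    Summable.of_norm_bounded summable_one_div_succ_rpow
      fun n => norm_cpowIntegralDefect_nat_le hx.1 hsU n
  refine tendsto_nhds_unique hsum.hasSum.tendsto_sum_nat ?_
  have h2 := h1.tendsto_sum_nat.sub (hlim.sub_const (((1 + x : ℝ) : ℂ) ^ (-s + 1) / (-s + 1)))
  simp only [Finset.range_one, Finset.sum_singleton, Nat.cast_zero, zero_add, zero_sub,
    sub_neg_eq_add] at h2
  refine h2.congr fun n => ?_
  have h3 := Finset.sum_range_sub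
    (fun n : ℕ => (((n : ℝ) + (1 + x) : ℝ) : ℂ) ^ (-s + 1) / (-s + 1)) n
  simp only [Nat.cast_zero, zero_add] at h3
  rw [← h3, ← Finset.sum_sub_distrib]
  refine Finset.sum_congr rfl fun k _ => ?_
  unfold cpowIntegralDefect
  rw [one_div, ← Complex.cpow_neg]
  push_cast
  ring_nf

/-- Both sides are holomorphic on the region, since the defects are $O(n^{-7/5})$ there, and they
agree near a point with $\Re s>1$. The identity theorem carries the formula to $1/2$. -/
theorem hurwitzZeta_eq_tsum_cpowIntegralDefect {x : ℝ} (hx : x ∈ Set.Icc 0 1) (hx0 : x ≠ 0) {s : ℂ}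
    (hs : s ∈ hurwitzRegion) :
    ∑' n : ℕ, cpowIntegralDefect (n + 1 + x) s =
      HurwitzZeta.hurwitzZeta x s - 1 / (x : ℂ) ^ s + ((1 + x : ℝ) : ℂ) ^ (-s + 1) / (-s + 1) := by
  have hx' : (x : ℂ) ≠ 0 := by exact_mod_cast hx0
  have hd1 : DifferentiableOn ℂ (fun s => ∑' n : ℕ, cpowIntegralDefect (n + 1 + x) s)
      hurwitzRegion :=
    Complex.differentiableOn_tsum_of_summable_norm summable_one_div_succ_rpow
      (fun n z hz => (differentiableAt_cpowIntegralDefect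
        (by linarith [n.cast_nonneg (α := ℝ), hx.1]) (ne_one_of_mem_hurwitzRegion hz)).differentiableWithinAt) isOpen_hurwitzRegion
      fun n z hz => norm_cpowIntegralDefect_nat_le hx.1 hz n
  have hd2 : DifferentiableOn ℂ (fun s => HurwitzZeta.hurwitzZeta x s - 1 / (x : ℂ) ^ s +
      ((1 + x : ℝ) : ℂ) ^ (-s + 1) / (-s + 1)) hurwitzRegion := by
    intro z hz
    refine DifferentiableAt.differentiableWithinAt (DifferentiableAt.add (DifferentiableAt.sub
      (HurwitzZeta.differentiableAt_hurwitzZeta _ (ne_one_of_mem_hurwitzRegion hz)) (DifferentiableAt.div (by fun_prop)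
        (differentiableAt_id.const_cpow (Or.inl hx')) ?_)) (DifferentiableAt.div
        (((differentiableAt_id.neg).add_const 1).const_cpow (Or.inl ?_)) (by fun_prop) ?_))
    · simp [Complex.cpow_eq_zero_iff, hx']
    · exact_mod_cast (by linarith [hx.1] : 1 + x ≠ 0)
    · intro h
      exact ne_one_of_mem_hurwitzRegion hz (by linear_combination -h)
  have hz₀ : (5 / 4 + 1 / 3 * Complex.I : ℂ) ∈ hurwitzRegion := by
    refine ⟨?_, ?_⟩
    · rw [Metric.mem_ball, dist_eq_norm, show (5 / 4 + 1 / 3 * Complex.I : ℂ) - 1 =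
        ((1 / 4 : ℝ) : ℂ) + ((1 / 3 : ℝ) : ℂ) * Complex.I by push_cast; ring,
        Complex.norm_add_mul_I]
      refine (Real.sqrt_lt' (by norm_num)).2 (by norm_num)
    · norm_num [Set.mem_ofPred_eq]
  refine (hd1.analyticOnNhd isOpen_hurwitzRegion).eqOn_of_preconnected_of_eventuallyEq (hd2.analyticOnNhd isOpen_hurwitzRegion)
    isPreconnected_hurwitzRegion hz₀ ?_ hs
  have hre : {z : ℂ | 1 < z.re} ∈ nhds (5 / 4 + 1 / 3 * Complex.I : ℂ) :=
    (isOpen_lt continuous_const Complex.continuous_re).mem_nhds (by norm_num)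
  filter_upwards [hre, isOpen_hurwitzRegion.mem_nhds hz₀] with z hz hz'
  exact tsum_cpowIntegralDefect_of_one_lt_re hx hz' hz

theorem exists_norm_hurwitzZeta_half_sub_le : ∃ C : ℝ, 0 ≤ C ∧ ∀ x : ℝ, 0 < x → x ≤ 1 →
    ‖HurwitzZeta.hurwitzZeta x (1 / 2) - 1 / (x : ℂ) ^ (1 / 2 : ℂ)‖ ≤ C := by
  refine ⟨∑' n : ℕ, 2 * (1 / ((n + 1 : ℕ) : ℝ) ^ (7 / 5 : ℝ)) + 4,
    add_nonneg (tsum_nonneg fun n => by positivity) (by norm_num), fun x hx0 hx1 => ?_⟩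
  have h := hurwitzZeta_eq_tsum_cpowIntegralDefect ⟨hx0.le, hx1⟩ hx0.ne' half_mem_hurwitzRegion
  rw [← sub_eq_iff_eq_add] at h
  rw [← h]
  refine (norm_sub_le _ _).trans (add_le_add ?_ ?_)
  · exact tsum_of_norm_bounded summable_one_div_succ_rpow.hasSum
      fun n => norm_cpowIntegralDefect_nat_le hx0.le half_mem_hurwitzRegion n
  · rw [norm_div, Complex.norm_cpow_eq_rpow_re_of_pos (by linarith)]
    have h1 : (1 + x) ^ (1 / 2 : ℝ) ≤ 2 := by
      calc _ ≤ (1 + x) ^ (1 : ℝ) := Real.rpow_le_rpow_of_exponent_le (by linarith) (by norm_num)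
        _ ≤ 2 := by rw [Real.rpow_one]; linarith
    norm_num at h1 ⊢
    linarith

/-! ### Equal powers modulo $q$ and orthogonality on a coset -/

/-- If $x\not\equiv y$, then $q$ divides $\sum_i x^iy^{K-1-i}$, a positive integer at most
$KB^{K-1}<q$. The degree $K-1$ of this cofactor is the origin of $K-1$ in the final exponent. -/
theorem eq_of_pow_zmod_eq_of_le {q K B x y : ℕ} [Fact q.Prime] (hK : 0 < K) (hB : B < q)
    (hKB : K * B ^ (K - 1) < q) (hx : 0 < x) (hxB : x ≤ B) (hy : 0 < y) (hyB : y ≤ B)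
    (h : (x : ZMod q) ^ K = (y : ZMod q) ^ K) : x = y := by
  have hmul := (Commute.all (x : ZMod q) (y : ZMod q)).geom_sum₂_mul K
  rw [h, sub_self, mul_eq_zero] at hmul
  rcases hmul with h0 | h0
  · exfalso
    have hc : ((∑ i ∈ Finset.range K, x ^ i * y ^ (K - 1 - i) : ℕ) : ZMod q) = 0 := by
      push_cast
      exact h0
    rw [ZMod.natCast_eq_zero_iff] at hc
    have hpos : 0 < ∑ i ∈ Finset.range K, x ^ i * y ^ (K - 1 - i) :=
      Finset.sum_pos (fun i _ => by positivity) ⟨0, Finset.mem_range.2 hK⟩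
    have hle : ∑ i ∈ Finset.range K, x ^ i * y ^ (K - 1 - i) ≤ K * B ^ (K - 1) := by
      refine (Finset.sum_le_card_nsmul _ _ (B ^ (K - 1)) fun i hi => ?_).trans
        (by rw [Finset.card_range, smul_eq_mul])
      have hi' := Finset.mem_range.1 hi
      calc x ^ i * y ^ (K - 1 - i) ≤ B ^ i * B ^ (K - 1 - i) :=
            Nat.mul_le_mul (Nat.pow_le_pow_left hxB i) (Nat.pow_le_pow_left hyB _)
        _ = B ^ (K - 1) := by rw [← pow_add]; congr 1; omega
    exact absurd (Nat.le_of_dvd hpos hc) (by omega)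
  · have h1 := (ZMod.natCast_eq_natCast_iff' x y q).1 (sub_eq_zero.1 h0)
    rwa [Nat.mod_eq_of_lt (by omega), Nat.mod_eq_of_lt (by omega)] at h1

theorem card_filter_mul_pow_eq_le {F : Type*} [Field F] [Fintype F] [DecidableEq F] {K : ℕ}
    (hK : 0 < K) {m : F} (hm : m ≠ 0) (n : F) :
    (Finset.univ.filter fun a : F => (a * m) ^ K = n ^ K).card ≤ K := by
  refine (Finset.card_le_card (t := (Polynomial.nthRoots K ((n / m) ^ K)).toFinset) ?_).trans
    ((Multiset.toFinset_card_le _).trans (Polynomial.card_nthRoots K _))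
  intro a ha
  have ha' := (Finset.mem_filter.1 ha).2
  rw [Multiset.mem_toFinset, Polynomial.mem_nthRoots hK, div_pow, ← ha', mul_pow,
    mul_div_cancel_right₀ _ (pow_ne_zero K hm)]

section CharacterSums

variable {q : ℕ}

/-- The sum of `χ x * conj (χ y)` over the characters `χ` in the coset `χ₁ • H`. -/
noncomputable def cosetSum (H : Subgroup (DirichletCharacter ℂ q)) [Fintype H]
    (χ₁ : DirichletCharacter ℂ q) (x y : ZMod q) : ℂ :=
  ∑ h : H, (χ₁ * h.1) x * starRingEnd ℂ ((χ₁ * h.1) y)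

theorem norm_cosetSum_le (H : Subgroup (DirichletCharacter ℂ q)) [Fintype H]
    (χ₁ : DirichletCharacter ℂ q) (x y : ZMod q) :
    ‖cosetSum H χ₁ x y‖ ≤ Fintype.card H := by
  refine (norm_sum_le _ _).trans ((Finset.sum_le_card_nsmul _ _ 1 fun h _ => ?_).trans ?_)
  · rw [norm_mul, RCLike.norm_conj]
    exact mul_le_one₀ (DirichletCharacter.norm_le_one _ _) (norm_nonneg _)
      (DirichletCharacter.norm_le_one _ _)
  · simp

theorem DirichletCharacter.mul_conj_self_of_ne_zero [Fact q.Prime] (χ : DirichletCharacter ℂ q) {x : ZMod q}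
    (hx : x ≠ 0) : χ x * starRingEnd ℂ (χ x) = 1 := by
  rw [Complex.mul_conj, Complex.normSq_eq_norm_sq]
  have := χ.unit_norm_eq_one (Units.mk0 x hx)
  rw [Units.val_mk0] at this
  rw [this]
  norm_num

theorem cosetSum_self [Fact q.Prime] (H : Subgroup (DirichletCharacter ℂ q)) [Fintype H]
    (χ₁ : DirichletCharacter ℂ q) {x : ZMod q} (hx : x ≠ 0) :
    cosetSum H χ₁ x x = Fintype.card H := by
  simp only [cosetSum, DirichletCharacter.mul_conj_self_of_ne_zero _ hx]
  simp

/-- Multiplication by $\chi\in H$ permutes the coset and scales the sum by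
$\chi(x)\overline{\chi(y)}$, so this factor is 1. -/
theorem apply_eq_apply_of_cosetSum_ne_zero [Fact q.Prime] {H : Subgroup (DirichletCharacter ℂ q)} [Fintype H]
    {χ₁ : DirichletCharacter ℂ q} {x y : ZMod q} (hy : y ≠ 0) (h : cosetSum H χ₁ x y ≠ 0)
    {χ : DirichletCharacter ℂ q} (hχ : χ ∈ H) : χ x = χ y := by
  have h1 : χ x * starRingEnd ℂ (χ y) * cosetSum H χ₁ x y = cosetSum H χ₁ x y := by
    unfold cosetSum
    rw [Finset.mul_sum]
    refine Fintype.sum_equiv (Equiv.mulLeft (⟨χ, hχ⟩ : H)) _ _ fun g => ?_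
    simp only [Equiv.coe_mulLeft, Subgroup.coe_mul, MulChar.mul_apply, map_mul]
    ring
  have h2 : χ x * starRingEnd ℂ (χ y) = 1 := mul_right_cancel₀ h (h1.trans (one_mul _).symm)
  have h3 := DirichletCharacter.mul_conj_self_of_ne_zero χ hy
  have h4 : starRingEnd ℂ (χ y) ≠ 0 := right_ne_zero_of_mul (h3 ▸ one_ne_zero)
  exact mul_right_cancel₀ h4 (h2.trans h3.symm)

/-- Since $\chi^K\in H$ for every $\chi$, no character separates $x^K$ from $y^K$, and the
characters modulo $q$ separate nonzero residues. -/
theorem pow_index_eq_of_cosetSum_ne_zero [Fact q.Prime] {H : Subgroup (DirichletCharacter ℂ q)} [Fintype H]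
    {χ₁ : DirichletCharacter ℂ q} {x y : ZMod q} (hy : y ≠ 0) (h : cosetSum H χ₁ x y ≠ 0) :
    x ^ H.index = y ^ H.index := by
  by_contra hne
  have hyK : y ^ H.index ≠ 0 := pow_ne_zero _ hy
  obtain ⟨χ, hχ⟩ := DirichletCharacter.exists_apply_ne_one_of_hasEnoughRootsOfUnity ℂ
    (a := x ^ H.index * (y ^ H.index)⁻¹) (fun h1 => hne (by
      rwa [mul_inv_eq_one₀ hyK] at h1))
  apply hχ
  have h1 := apply_eq_apply_of_cosetSum_ne_zero hy h (H.pow_index_mem χ)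
  have hK : H.index ≠ 0 := Subgroup.index_ne_zero_of_finite
  rw [MulChar.pow_apply' _ hK, MulChar.pow_apply' _ hK, ← map_pow, ← map_pow] at h1
  rw [map_mul, h1, ← map_mul, mul_inv_cancel₀ hyK, map_one]

end CharacterSums

/-! ### The central value as a finite sum of character values -/

section LFormula

variable {q : ℕ} [Fact q.Prime]

/-- The coefficients of `L(χ, 1/2)` as a linear combination of the values of `χ`. -/
noncomputable def centralCoeff (q : ℕ) [NeZero q] (j : ZMod q) : ℂ :=
  (q : ℂ) ^ (-(1 / 2 : ℂ)) * HurwitzZeta.hurwitzZeta (ZMod.toAddCircle j) (1 / 2)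

theorem LFunction_half_eq_sum (χ : DirichletCharacter ℂ q) :
    DirichletCharacter.LFunction χ (1 / 2) = ∑ j : ZMod q, centralCoeff q j * χ j := by
  rw [DirichletCharacter.LFunction, ZMod.LFunction, Finset.mul_sum]
  refine Finset.sum_congr rfl fun j _ => ?_
  unfold centralCoeff
  ring

theorem natCast_cpow_neg_half (n : ℕ) :
    (n : ℂ) ^ (-(1 / 2 : ℂ)) = ((1 / Real.sqrt n : ℝ) : ℂ) := by
  rw [Real.sqrt_eq_rpow, one_div ((n : ℝ) ^ _), ← Real.rpow_neg (Nat.cast_nonneg n),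
    Complex.ofReal_cpow (Nat.cast_nonneg n)]
  push_cast
  norm_num

/-- The term $x^{-1/2}$ of the Hurwitz zeta function at $x=j/q$ becomes $1/\sqrt j$ after scaling by
$q^{-1/2}$. The rest is bounded uniformly in $x$. -/
theorem exists_norm_centralCoeff_sub_le : ∃ C : ℝ, 0 ≤ C ∧ ∀ (q : ℕ) [Fact q.Prime] (j : ZMod q),
    j ≠ 0 → ‖centralCoeff q j - ((1 / Real.sqrt j.val : ℝ) : ℂ)‖ ≤ C / Real.sqrt q := by
  obtain ⟨C, hC, h⟩ := exists_norm_hurwitzZeta_half_sub_le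
  refine ⟨C, hC, fun q _ j hj => ?_⟩
  have hq : 0 < q := (Fact.out : q.Prime).pos
  have hq0 : (0 : ℝ) < q := by exact_mod_cast hq
  have hv : 0 < j.val := ZMod.val_pos.2 hj
  have hv0 : (0 : ℝ) < j.val := by exact_mod_cast hv
  have hx0 : 0 < (j.val : ℝ) / q := div_pos hv0 hq0
  have hx1 : (j.val : ℝ) / q ≤ 1 := (div_le_one hq0).2 (by exact_mod_cast (ZMod.val_lt j).le)
  have h1 := h _ hx0 hx1
  have h2 : 1 / ((j.val / q : ℝ) : ℂ) ^ (1 / 2 : ℂ) = ((Real.sqrt q / Real.sqrt j.val : ℝ) : ℂ) := by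
    rw [← Real.sqrt_div' _ hv0.le, ← inv_div (j.val : ℝ) q, Real.sqrt_inv, Real.sqrt_eq_rpow,
      Complex.ofReal_inv, Complex.ofReal_cpow hx0.le, one_div]
    push_cast
    norm_num
  have h3 : centralCoeff q j - ((1 / Real.sqrt j.val : ℝ) : ℂ) = ((1 / Real.sqrt q : ℝ) : ℂ) *
      (HurwitzZeta.hurwitzZeta ((j.val / q : ℝ) : UnitAddCircle) (1 / 2) -
        1 / ((j.val / q : ℝ) : ℂ) ^ (1 / 2 : ℂ)) := by
    have hs : Real.sqrt q ≠ 0 := (Real.sqrt_pos.2 hq0).ne'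
    rw [h2, mul_sub, ← Complex.ofReal_mul, centralCoeff, natCast_cpow_neg_half,
      ZMod.toAddCircle_apply]
    congr 2
    field_simp
  rw [h3, norm_mul, Complex.norm_of_nonneg (by positivity), div_eq_mul_one_div C, mul_comm C]
  exact mul_le_mul_of_nonneg_left h1 (by positivity)

end LFormula

/-! ### Resonance over a coset -/

section Resonance

variable {q : ℕ} [Fact q.Prime]

theorem norm_sum_centralCoeff_mul_cosetSum_sub_le {C N L₀ : ℝ} (hC : 0 ≤ C)
    (hCq : ∀ j : ZMod q, j ≠ 0 →
      ‖centralCoeff q j - ((1 / Real.sqrt j.val : ℝ) : ℂ)‖ ≤ C / Real.sqrt q)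
    (H : Subgroup (DirichletCharacter ℂ q)) [Fintype H] (χ₁ : DirichletCharacter ℂ q)
    (hN : 1 ≤ N) (hNL : N ≤ L₀) (hLq : L₀ ≤ q) (hB : ⌊L₀ * N⌋₊ < q)
    (hKB : H.index * ⌊L₀ * N⌋₊ ^ (H.index - 1) < q) {m n : ℕ} (hm : m ∈ Finset.Icc 1 ⌊N⌋₊)
    (hn : n ∈ Finset.Icc 1 ⌊N⌋₊) :
    ‖∑ a : ZMod q, centralCoeff q a * cosetSum H χ₁ (a * m) n -
      if m ∣ n then ((Fintype.card H / Real.sqrt (n / m : ℝ) : ℝ) : ℂ) else 0‖ ≤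
      Fintype.card H * (H.index * (1 + C) / Real.sqrt L₀) := by
  classical
  have hN0 : 0 ≤ N := by linarith
  have hL1 : 1 ≤ L₀ := hN.trans hNL
  have hL0 : 0 < L₀ := by linarith
  obtain ⟨hm1, hmN⟩ := Finset.mem_Icc.1 hm
  obtain ⟨hn1, hnN⟩ := Finset.mem_Icc.1 hn
  have hmR : (m : ℝ) ≤ N := (Nat.le_floor_iff hN0).1 hmN
  have hnR : (n : ℝ) ≤ N := (Nat.le_floor_iff hN0).1 hnN
  have hNB : N ≤ L₀ * N := le_mul_of_one_le_left hN0 hL1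
  have hnB : n ≤ ⌊L₀ * N⌋₊ := Nat.le_floor (hnR.trans hNB)
  have hmB : m ≤ ⌊L₀ * N⌋₊ := Nat.le_floor (hmR.trans hNB)
  have hK : 0 < H.index := Nat.pos_of_ne_zero Subgroup.index_ne_zero_of_finite
  have hne : ∀ k : ℕ, 1 ≤ k → k ≤ ⌊L₀ * N⌋₊ → (k : ZMod q) ≠ 0 := fun k hk1 hk h0 => by
    rw [ZMod.natCast_eq_zero_iff] at h0
    exact absurd (Nat.le_of_dvd hk1 h0) (by omega)
  have hm0 := hne m hm1 hmB
  have hn0 := hne n hn1 hnB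
  have hcast : ∀ a : ZMod q, ((a.val : ℕ) : ZMod q) = a := ZMod.natCast_zmod_val
  have hmain : (if m ∣ n then ((Fintype.card H / Real.sqrt (n / m : ℝ) : ℝ) : ℂ) else 0) =
      ∑ a : ZMod q, if a.val * m = n then
        ((Fintype.card H / Real.sqrt a.val : ℝ) : ℂ) else 0 := by
    split_ifs with hd
    · obtain ⟨k, rfl⟩ := hd
      have hkq : k < q := (Nat.le_mul_of_pos_left k hm1).trans_lt (by omega)
      rw [Finset.sum_eq_single ((k : ℕ) : ZMod q)]
      · rw [ZMod.val_natCast_of_lt hkq, if_pos (mul_comm _ _)]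
        congr 3
        have : (m : ℝ) ≠ 0 := by positivity
        push_cast
        field_simp
      · intro a _ ha
        refine if_neg fun h => ha ?_
        rw [← hcast a, Nat.eq_of_mul_eq_mul_right hm1 (h.trans (mul_comm m k))]
      · exact fun h => absurd (Finset.mem_univ _) h
    · refine (Finset.sum_eq_zero fun a _ => if_neg fun h => hd ?_).symm
      exact h ▸ Dvd.intro_left _ rfl
  rw [hmain, ← Finset.sum_sub_distrib]
  set s := Finset.univ.filter fun a : ZMod q => (a * m) ^ H.index = (n : ZMod q) ^ H.index with hs
  have hval : ∀ a : ZMod q, a.val * m = n → a * m = (n : ZMod q) := fun a h => by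
    rw [← h]; push_cast; rw [hcast]
  have hzero : ∀ a ∉ s, centralCoeff q a * cosetSum H χ₁ (a * m) n -
      (if a.val * m = n then ((Fintype.card H / Real.sqrt a.val : ℝ) : ℂ) else 0) = 0 := by
    intro a ha
    have ha' : ¬ (a * m) ^ H.index = (n : ZMod q) ^ H.index := fun h =>
      ha (Finset.mem_filter.2 ⟨Finset.mem_univ a, h⟩)
    have h1 : cosetSum H χ₁ (a * m) n = 0 := by
      by_contra h
      exact ha' (pow_index_eq_of_cosetSum_ne_zero hn0 h)
    rw [h1, if_neg fun h => ha' (by rw [hval a h])]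
    simp
  rw [← Finset.sum_subset (Finset.subset_univ s) fun a _ ha => hzero a ha]
  have hsqrtLq : Real.sqrt L₀ ≤ Real.sqrt q := Real.sqrt_le_sqrt hLq
  have hsqrtL : 0 < Real.sqrt L₀ := Real.sqrt_pos.2 hL0
  have hCL : C / Real.sqrt q ≤ C / Real.sqrt L₀ := div_le_div_of_nonneg_left hC hsqrtL hsqrtLq
  have hterm : ∀ a ∈ s, ‖centralCoeff q a * cosetSum H χ₁ (a * m) n -
      (if a.val * m = n then ((Fintype.card H / Real.sqrt a.val : ℝ) : ℂ) else 0)‖ ≤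
      Fintype.card H * ((1 + C) / Real.sqrt L₀) := by
    intro a ha
    have hpow := (Finset.mem_filter.1 ha).2
    have ha0 : a ≠ 0 := by
      rintro rfl
      rw [zero_mul, zero_pow hK.ne'] at hpow
      exact pow_ne_zero _ hn0 hpow.symm
    have hav : 0 < a.val := ZMod.val_pos.2 ha0
    -- For $a\le L_0$ both $am$ and $n$ are at most $L_0N$, so equal powers force $am=n$ and only
    -- the coefficient error remains. For $a>L_0$ the equality $am=n\le N\le L_0$ is impossible, and
    -- the whole term is error.
    rcases le_or_gt (a.val : ℝ) L₀ with hle | hgt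
    · have hamB : a.val * m ≤ ⌊L₀ * N⌋₊ := Nat.le_floor (by
        push_cast
        exact mul_le_mul hle hmR (Nat.cast_nonneg m) hL0.le)
      have heq : a.val * m = n := eq_of_pow_zmod_eq_of_le hK hB hKB (Nat.mul_pos hav hm1) hamB
        hn1 hnB (by push_cast; rw [hcast]; exact hpow)
      rw [if_pos heq, hval a heq, cosetSum_self H χ₁ hn0]
      have h1 : centralCoeff q a * (Fintype.card H : ℂ) -
          ((Fintype.card H / Real.sqrt a.val : ℝ) : ℂ) =
          Fintype.card H * (centralCoeff q a - ((1 / Real.sqrt a.val : ℝ) : ℂ)) := by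
        push_cast; ring
      rw [h1, norm_mul, Complex.norm_natCast]
      refine mul_le_mul_of_nonneg_left ((hCq a ha0).trans (hCL.trans ?_)) (Nat.cast_nonneg _)
      exact div_le_div_of_nonneg_right (by linarith) hsqrtL.le
    · have hne' : ¬ a.val * m = n := fun h => by
        have h1 : (a.val : ℝ) ≤ n := by exact_mod_cast h ▸ Nat.le_mul_of_pos_right a.val hm1
        linarith
      rw [if_neg hne', sub_zero, norm_mul, mul_comm]
      refine mul_le_mul (norm_cosetSum_le H χ₁ _ _) ?_ (norm_nonneg _) (Nat.cast_nonneg _)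
      have h1 : ‖centralCoeff q a‖ ≤ C / Real.sqrt q + 1 / Real.sqrt a.val := by
        have h2 := norm_add_le (centralCoeff q a - ((1 / Real.sqrt a.val : ℝ) : ℂ))
          ((1 / Real.sqrt a.val : ℝ) : ℂ)
        rw [sub_add_cancel, Complex.norm_of_nonneg (by positivity)] at h2
        linarith [hCq a ha0]
      have h3 : 1 / Real.sqrt a.val ≤ 1 / Real.sqrt L₀ :=
        one_div_le_one_div_of_le hsqrtL (Real.sqrt_le_sqrt hgt.le)
      rw [add_div]
      linarith
  refine (norm_sum_le_of_le s hterm).trans ?_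
  rw [Finset.sum_const, nsmul_eq_mul]
  have hcard : (s.card : ℝ) ≤ H.index := by exact_mod_cast card_filter_mul_pow_eq_le hK hm0 _
  calc _ ≤ (H.index : ℝ) * (Fintype.card H * ((1 + C) / Real.sqrt L₀)) :=
        mul_le_mul_of_nonneg_right hcard (by positivity)
    _ = _ := by ring

end Resonance

section Resonance

variable {q : ℕ} [Fact q.Prime]

/-- The value at `χ` of the Dirichlet polynomial with coefficients `r`, supported on `D`. -/
noncomputable def resonatorValue (D : Finset ℕ) (r : ℕ → ℝ) (χ : DirichletCharacter ℂ q) : ℂ :=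
  ∑ n ∈ D, (r n : ℂ) * χ (n : ZMod q)

theorem resonatorValue_mul_conj (D : Finset ℕ) (r : ℕ → ℝ) (χ : DirichletCharacter ℂ q) :
    resonatorValue D r χ * starRingEnd ℂ (resonatorValue D r χ) =
      ∑ m ∈ D, ∑ n ∈ D, (r m * r n : ℂ) * (χ (m : ZMod q) * starRingEnd ℂ (χ (n : ZMod q))) := by
  unfold resonatorValue
  rw [map_sum, Finset.sum_mul_sum]
  refine Finset.sum_congr rfl fun m _ => Finset.sum_congr rfl fun n _ => ?_
  rw [map_mul, Complex.conj_ofReal]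
  ring

theorem sum_resonatorValue_sq (D : Finset ℕ) (r : ℕ → ℝ) (H : Subgroup (DirichletCharacter ℂ q))
    [Fintype H] (χ₁ : DirichletCharacter ℂ q) :
    ∑ h : H, resonatorValue D r (χ₁ * h.1) * starRingEnd ℂ (resonatorValue D r (χ₁ * h.1)) =
      ∑ m ∈ D, ∑ n ∈ D, (r m * r n : ℂ) * cosetSum H χ₁ m n := by
  simp only [resonatorValue_mul_conj]
  rw [Finset.sum_comm]
  refine Finset.sum_congr rfl fun m _ => ?_
  rw [Finset.sum_comm]
  refine Finset.sum_congr rfl fun n _ => ?_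
  rw [cosetSum, Finset.mul_sum]

theorem sum_LFunction_mul_resonatorValue_sq (D : Finset ℕ) (r : ℕ → ℝ)
    (H : Subgroup (DirichletCharacter ℂ q)) [Fintype H] (χ₁ : DirichletCharacter ℂ q) :
    ∑ h : H, DirichletCharacter.LFunction (χ₁ * h.1) (1 / 2) *
        (resonatorValue D r (χ₁ * h.1) * starRingEnd ℂ (resonatorValue D r (χ₁ * h.1))) =
      ∑ m ∈ D, ∑ n ∈ D, (r m * r n : ℂ) *
        ∑ a : ZMod q, centralCoeff q a * cosetSum H χ₁ (a * m) n := by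
  simp only [resonatorValue_mul_conj, Finset.mul_sum]
  rw [Finset.sum_comm]
  refine Finset.sum_congr rfl fun m _ => ?_
  rw [Finset.sum_comm]
  refine Finset.sum_congr rfl fun n _ => ?_
  simp only [LFunction_half_eq_sum, Finset.sum_mul, cosetSum, Finset.mul_sum]
  rw [Finset.sum_comm]
  refine Finset.sum_congr rfl fun a _ => Finset.sum_congr rfl fun h _ => ?_
  rw [map_mul]
  ring

theorem exists_mem_coset_norm_LFunction_ge {C N L₀ V : ℝ} (hC : 0 ≤ C)
    (hCq : ∀ j : ZMod q, j ≠ 0 →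
      ‖centralCoeff q j - ((1 / Real.sqrt j.val : ℝ) : ℂ)‖ ≤ C / Real.sqrt q)
    (H : Subgroup (DirichletCharacter ℂ q)) (χ₁ : DirichletCharacter ℂ q)
    (hN : 1 ≤ N) (hNL : N ≤ L₀) (hLq : L₀ ≤ q) (hB : ⌊L₀ * N⌋₊ < q)
    (hKB : H.index * ⌊L₀ * N⌋₊ ^ (H.index - 1) < q) {r : ℕ → ℝ} (hr : ∀ n, 0 ≤ r n)
    (hr0 : 0 < ∑ n ∈ Finset.Icc 1 ⌊N⌋₊, r n ^ 2)
    (hV : V * ∑ n ∈ Finset.Icc 1 ⌊N⌋₊, r n ^ 2 ≤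
      ∑ n ∈ Finset.Icc 1 ⌊N⌋₊, ∑ m ∈ n.divisors, r m * r n / Real.sqrt (n / m : ℝ)) :
    ∃ χ ∈ χ₁ • (H : Set (DirichletCharacter ℂ q)),
      V - H.index * (1 + C) * N / Real.sqrt L₀ ≤
        ‖DirichletCharacter.LFunction χ (1 / 2)‖ := by
  classical
  have : Fintype H := Fintype.ofFinite H
  have hN0 : 0 ≤ N := by linarith
  have hL1 : 1 ≤ L₀ := hN.trans hNL
  have hK : 0 < H.index := Nat.pos_of_ne_zero Subgroup.index_ne_zero_of_finite
  have hNB : ⌊N⌋₊ ≤ ⌊L₀ * N⌋₊ := Nat.floor_mono (le_mul_of_one_le_left hN0 hL1)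
  have hcard : (0 : ℝ) < Fintype.card H := by exact_mod_cast Fintype.card_pos
  set D := Finset.Icc 1 ⌊N⌋₊ with hD
  set Q := ∑ n ∈ D, r n ^ 2 with hQ
  obtain ⟨h₀, hmax⟩ := Finite.exists_max
    (fun h : H => ‖DirichletCharacter.LFunction (χ₁ * h.1) (1 / 2)‖)
  refine ⟨χ₁ * h₀.1, ⟨h₀.1, h₀.2, rfl⟩, ?_⟩
  set B := ‖DirichletCharacter.LFunction (χ₁ * h₀.1) (1 / 2)‖ with hBdef
  -- Distinct integers up to $N$ have distinct $K$-th powers modulo $q$, so only the diagonal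
  -- survives.
  have hdiag : ∑ h : H, resonatorValue D r (χ₁ * h.1) *
      starRingEnd ℂ (resonatorValue D r (χ₁ * h.1)) = ((Fintype.card H * Q : ℝ) : ℂ) := by
    rw [sum_resonatorValue_sq, hQ]
    push_cast
    rw [Finset.mul_sum]
    refine Finset.sum_congr rfl fun m hm => ?_
    obtain ⟨hm1, hmN⟩ := Finset.mem_Icc.1 hm
    have hne : ∀ n ∈ D, (n : ZMod q) ≠ 0 := fun n hn h0 => by
      obtain ⟨hn1, hnN⟩ := Finset.mem_Icc.1 hn
      rw [ZMod.natCast_eq_zero_iff] at h0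
      exact absurd (Nat.le_of_dvd hn1 h0) (by omega)
    rw [Finset.sum_eq_single m]
    · rw [cosetSum_self H χ₁ (hne m hm)]
      ring
    · intro n hn hnm
      obtain ⟨hn1, hnN⟩ := Finset.mem_Icc.1 hn
      have : cosetSum H χ₁ (m : ZMod q) n = 0 := by
        by_contra h
        exact hnm (eq_of_pow_zmod_eq_of_le hK hB hKB hm1 (hmN.trans hNB) hn1 (hnN.trans hNB)
          (pow_index_eq_of_cosetSum_ne_zero (hne n hn) h)).symm
      rw [this, mul_zero]
    · exact fun h => absurd hm h
  have hnormsq : ∀ z : ℂ, z * starRingEnd ℂ z = ((‖z‖ ^ 2 : ℝ) : ℂ) := fun z => by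
    rw [Complex.mul_conj, Complex.normSq_eq_norm_sq]
  have hS1 : ∑ h : H, ‖resonatorValue D r (χ₁ * h.1)‖ ^ 2 = Fintype.card H * Q := by
    simp only [hnormsq] at hdiag
    exact_mod_cast hdiag
  have hup : ‖∑ h : H, DirichletCharacter.LFunction (χ₁ * h.1) (1 / 2) *
        (resonatorValue D r (χ₁ * h.1) * starRingEnd ℂ (resonatorValue D r (χ₁ * h.1)))‖ ≤
      B * (Fintype.card H * Q) := by
    rw [← hS1, Finset.mul_sum]
    refine norm_sum_le_of_le _ fun h _ => ?_
    rw [norm_mul, hnormsq, Complex.norm_of_nonneg (by positivity)]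
    exact mul_le_mul_of_nonneg_right (hmax h) (by positivity)
  have hmainsum : ∑ n ∈ D, ∑ m ∈ n.divisors, r m * r n / Real.sqrt (n / m : ℝ) =
      ∑ m ∈ D, ∑ n ∈ D, r m * r n * if m ∣ n then 1 / Real.sqrt (n / m : ℝ) else 0 := by
    rw [Finset.sum_comm]
    refine Finset.sum_congr rfl fun n hn => ?_
    obtain ⟨hn1, hnN⟩ := Finset.mem_Icc.1 hn
    have : n.divisors = D.filter (· ∣ n) := by
      ext m
      simp only [Nat.mem_divisors, hD, Finset.mem_filter, Finset.mem_Icc]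
      refine ⟨fun h => ⟨⟨Nat.pos_of_dvd_of_pos h.1 hn1, (Nat.le_of_dvd hn1 h.1).trans hnN⟩, h.1⟩,
        fun h => ⟨h.2, by omega⟩⟩
    rw [this, Finset.sum_filter]
    refine Finset.sum_congr rfl fun m _ => ?_
    split_ifs
    · ring
    · ring
  set ε := (H.index : ℝ) * (1 + C) / Real.sqrt L₀ with hε
  have hε0 : 0 ≤ ε := by positivity
  have hlow : ‖∑ h : H, DirichletCharacter.LFunction (χ₁ * h.1) (1 / 2) *
        (resonatorValue D r (χ₁ * h.1) * starRingEnd ℂ (resonatorValue D r (χ₁ * h.1))) -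
      ((Fintype.card H * ∑ n ∈ D, ∑ m ∈ n.divisors,
        r m * r n / Real.sqrt (n / m : ℝ) : ℝ) : ℂ)‖ ≤ Fintype.card H * ε * (N * Q) := by
    rw [hmainsum, sum_LFunction_mul_resonatorValue_sq, Finset.mul_sum, Complex.ofReal_sum,
      ← Finset.sum_sub_distrib]
    -- Cauchy–Schwarz over the pairs $(m,n)$ is the source of the factor $N$ in the error.
    have hCS : (∑ n ∈ D, r n) ^ 2 ≤ N * Q := by
      refine sq_sum_le_card_mul_sum_sq.trans (mul_le_mul_of_nonneg_right ?_ hr0.le)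
      rw [hD, Nat.card_Icc, Nat.add_sub_cancel]
      exact Nat.floor_le hN0
    refine le_trans ?_ (mul_le_mul_of_nonneg_left hCS (by positivity))
    rw [pow_two, Finset.sum_mul_sum, Finset.mul_sum]
    refine norm_sum_le_of_le _ fun m hm => ?_
    rw [Finset.mul_sum, Complex.ofReal_sum, ← Finset.sum_sub_distrib, Finset.mul_sum]
    refine norm_sum_le_of_le _ fun n hn => ?_
    have h1 := norm_sum_centralCoeff_mul_cosetSum_sub_le hC hCq H χ₁ hN hNL hLq hB hKB hm hn
    have h2 : (r m * r n : ℂ) * ∑ a : ZMod q, centralCoeff q a * cosetSum H χ₁ (a * m) n -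
        ((Fintype.card H * (r m * r n * if m ∣ n then 1 / Real.sqrt (n / m : ℝ) else 0) : ℝ) : ℂ) =
        ((r m * r n : ℝ) : ℂ) * (∑ a : ZMod q, centralCoeff q a * cosetSum H χ₁ (a * m) n -
          if m ∣ n then ((Fintype.card H / Real.sqrt (n / m : ℝ) : ℝ) : ℂ) else 0) := by
      split_ifs <;> push_cast <;> ring
    rw [h2, norm_mul, Complex.norm_of_nonneg (mul_nonneg (hr m) (hr n)), mul_comm]
    exact mul_le_mul_of_nonneg_right h1 (mul_nonneg (hr m) (hr n))
  have hM0 : 0 ≤ ∑ n ∈ D, ∑ m ∈ n.divisors, r m * r n / Real.sqrt (n / m : ℝ) :=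
    Finset.sum_nonneg fun n _ => Finset.sum_nonneg fun m _ =>
      div_nonneg (mul_nonneg (hr m) (hr n)) (Real.sqrt_nonneg _)
  have htri := norm_sub_norm_le ((Fintype.card H * ∑ n ∈ D, ∑ m ∈ n.divisors,
        r m * r n / Real.sqrt (n / m : ℝ) : ℝ) : ℂ) (∑ h : H,
      DirichletCharacter.LFunction (χ₁ * h.1) (1 / 2) *
        (resonatorValue D r (χ₁ * h.1) * starRingEnd ℂ (resonatorValue D r (χ₁ * h.1))))
  rw [norm_sub_rev, Complex.norm_of_nonneg (mul_nonneg hcard.le hM0)] at htri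
  have hfin : (Fintype.card H * Q) * (V - H.index * (1 + C) * N / Real.sqrt L₀) ≤
      (Fintype.card H * Q) * B := by
    have h3 := mul_le_mul_of_nonneg_left hV hcard.le
    have h4 : (H.index : ℝ) * (1 + C) * N / Real.sqrt L₀ = ε * N := by rw [hε]; ring
    rw [h4]
    nlinarith
  exact le_of_mul_le_mul_left hfin (mul_pos hcard hr0)

end Resonance

/-! ### Choice of parameters and conclusion -/

/-- Here $x=\log q$. After $x\ge3$, the conditions serve: $KB^{K-1}<q$, error at most 1 in the
resonance bound, a resonator length that is large enough, and absorption of that error into $\eta$.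
-/
theorem eventually_parameter_conditions {ε C η δ C' X₀ : ℝ} (hε : 0 < ε) (hC : 0 < C)
    (hδ : 0 < δ) (hδ1 : δ < 1) :
    ∀ᶠ x : ℝ in Filter.atTop, 3 ≤ x ∧ C * x < Real.exp (δ / 2 * x) ∧
      C * x * (1 + C') * Real.exp (-(δ / 4 / C) * x ^ ε) ≤ 1 ∧
      max X₀ 2 ≤ (1 - δ) / 3 * (x ^ ε / C) ∧ (2 / η) ^ 2 * C * Real.log x ≤ x ^ ε := by
  have hu : Filter.Tendsto (fun x : ℝ => x ^ ε) Filter.atTop Filter.atTop := tendsto_rpow_atTop hε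
  refine (Filter.eventually_ge_atTop 3).and (Filter.Eventually.and ?_ (Filter.Eventually.and ?_
    (Filter.Eventually.and ?_ ?_)))
  · have h := (tendsto_rpow_mul_exp_neg_mul_atTop_nhds_zero 1 (δ / 2) (by positivity)).const_mul C
    rw [mul_zero] at h
    filter_upwards [h.eventually (gt_mem_nhds one_pos)] with x hx
    rw [Real.rpow_one, neg_mul, Real.exp_neg, ← mul_assoc, ← div_eq_mul_inv,
      div_lt_one (Real.exp_pos _)] at hx
    exact hx
  · have h := ((tendsto_rpow_mul_exp_neg_mul_atTop_nhds_zero (1 / ε) (δ / 4 / C)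
      (by positivity)).comp hu).const_mul (C * (1 + C'))
    rw [mul_zero] at h
    filter_upwards [h.eventually (gt_mem_nhds one_pos), Filter.eventually_ge_atTop 0] with x hx hx0
    simp only [Function.comp_apply] at hx
    rw [← Real.rpow_mul hx0, mul_one_div_cancel hε.ne', Real.rpow_one] at hx
    linarith
  · exact ((hu.atTop_div_const hC).const_mul_atTop
      (div_pos (by linarith) (by norm_num))).eventually_ge_atTop _
  · have hk : 0 < 1 / ((2 / η) ^ 2 * C + 1) := by positivity
    filter_upwards [(isLittleO_log_rpow_atTop hε).bound hk, Filter.eventually_ge_atTop 1]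
      with x hx hx1
    have hl := Real.log_nonneg hx1
    rw [Real.norm_of_nonneg hl, Real.norm_of_nonneg (by positivity), div_mul_eq_mul_div, one_mul,
      le_div_iff₀ (by positivity)] at hx
    nlinarith

theorem exp_add_one_le_exp {a b : ℝ} (ha : 0 ≤ a) (hab : a + 1 ≤ b) :
    Real.exp a + 1 ≤ Real.exp b := by
  have h1 : Real.exp (a + 1) ≤ Real.exp b := Real.exp_le_exp.2 hab
  rw [Real.exp_add] at h1
  have h2 := Real.one_le_exp ha
  have h3 := Real.add_one_le_exp (1 : ℝ)
  nlinarith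

theorem exp_add_one_le_exp_resonator_exponent {η t x : ℝ} (hη : 0 < η)
    (hη1 : η ≤ 1 / Real.sqrt 3) (hlx : 0 < Real.log x) (ht0 : 0 < t) (htx : t ≤ x)
    (hy : 2 ≤ (1 - η / 4) / 3 * t) (hZlarge : 2 / η ≤ Real.sqrt (t / Real.log x)) :
    Real.exp ((1 / Real.sqrt 3 - η) * Real.sqrt (t / Real.log x)) + 1 ≤
      Real.exp ((1 - η / 4) * Real.sqrt ((1 - η / 4) / 3 * t /
        Real.log ((1 - η / 4) / 3 * t))) := by
  have hs3 : 1 < Real.sqrt 3 := Real.lt_sqrt_of_sq_lt (by norm_num)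
  have h5 : 1 / Real.sqrt 3 ≤ 1 := (div_le_one (by linarith)).2 hs3.le
  have h6 : 0 ≤ 1 / Real.sqrt 3 := by positivity
  set δ := η / 4 with hδ
  have hδ0 : 0 < δ := by positivity
  have hδ1 : δ < 1 := by linarith
  set y := (1 - δ) / 3 * t with hydef
  set Z := Real.sqrt (t / Real.log x) with hZ
  have hZ0 : 0 ≤ Z := Real.sqrt_nonneg _
  have h1 : Real.log y ≤ Real.log x := by
    refine Real.log_le_log (by linarith) ?_
    exact (mul_le_of_le_one_left ht0.le (by linarith)).trans htx
  have h2 : 0 < Real.log y := Real.log_pos (by linarith)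
  have h3 : (1 - δ) * (1 / Real.sqrt 3) * Z ≤ Real.sqrt (y / Real.log y) := by
    refine Real.le_sqrt_of_sq_le ?_
    rw [mul_pow, mul_pow, Real.sq_sqrt (by positivity), div_pow, one_pow,
      Real.sq_sqrt (by norm_num)]
    have h7 : (1 - δ) ^ 2 ≤ 1 - δ := by
      rw [pow_two]
      exact mul_le_of_le_one_left (by linarith) (by linarith)
    calc (1 - δ) ^ 2 * (1 / 3) * (t / Real.log x) ≤ (1 - δ) * (1 / 3) * (t / Real.log x) :=
          mul_le_mul_of_nonneg_right (mul_le_mul_of_nonneg_right h7 (by norm_num)) (by positivity)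
      _ = y / Real.log x := by rw [hydef]; ring
      _ ≤ _ := div_le_div_of_nonneg_left (by linarith) h2 h1
  have h4 : 1 / Real.sqrt 3 - η / 2 ≤ (1 - δ) * ((1 - δ) * (1 / Real.sqrt 3)) := by
    have h8 : δ * (1 / Real.sqrt 3) ≤ δ * 1 := mul_le_mul_of_nonneg_left h5 hδ0.le
    have h9 : 0 ≤ δ ^ 2 * (1 / Real.sqrt 3) := by positivity
    have h10 : (1 - δ) * ((1 - δ) * (1 / Real.sqrt 3)) =
      1 / Real.sqrt 3 - 2 * (δ * (1 / Real.sqrt 3)) + δ ^ 2 * (1 / Real.sqrt 3) := by ring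
    rw [h10]
    linarith
  have hV : (1 / Real.sqrt 3 - η / 2) * Z ≤ (1 - δ) * Real.sqrt (y / Real.log y) := by
    calc _ ≤ (1 - δ) * ((1 - δ) * (1 / Real.sqrt 3)) * Z := mul_le_mul_of_nonneg_right h4 hZ0
      _ = (1 - δ) * ((1 - δ) * (1 / Real.sqrt 3) * Z) := by ring
      _ ≤ _ := mul_le_mul_of_nonneg_left h3 (by linarith)
  refine exp_add_one_le_exp (mul_nonneg (by linarith) hZ0) (le_trans ?_ hV)
  rw [div_le_iff₀ hη] at hZlarge
  linarith

/-- Every coset of a subgroup of index `K` contains a character with a large central value, with the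
constant `1 / √(max (K - 1) 1)`, whatever the parities of its members. -/
theorem eventually_exists_mem_coset_norm_LFunction_ge {ε C η : ℝ} (hε : 0 < ε) (hC : 0 < C)
    (hη : 0 < η) (hη1 : η ≤ 1 / Real.sqrt 3) :
    ∃ q₀ : ℕ, ∀ (q : ℕ) [Fact q.Prime], q₀ ≤ q → ∀ H : Subgroup (DirichletCharacter ℂ q),
      (H.index : ℝ) ≤ C * (Real.log q) ^ (1 - ε) → ∀ χ₁ : DirichletCharacter ℂ q,
      ∃ χ ∈ χ₁ • (H : Set (DirichletCharacter ℂ q)),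
        Real.exp (1 / Real.sqrt (max ((H.index : ℝ) - 1) 1) * (1 / Real.sqrt 3 - η) * scaleL q) ≤
          ‖DirichletCharacter.LFunction χ (1 / 2)‖ := by
  have hs3 : 1 < Real.sqrt 3 := Real.lt_sqrt_of_sq_lt (by norm_num)
  have hη2 : η < 1 := hη1.trans_lt ((div_lt_one (by linarith)).2 hs3)
  set δ := η / 4 with hδdef
  have hδ : 0 < δ := by positivity
  have hδ1 : δ < 1 := by linarith
  obtain ⟨X₀, hX₀⟩ := exists_resonator hδ hδ1
  obtain ⟨C', hC', hcoeff⟩ := exists_norm_centralCoeff_sub_le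
  obtain ⟨x₀, hx₀⟩ := Filter.eventually_atTop.1
    (eventually_parameter_conditions (η := η) (C' := C') (X₀ := X₀) hε hC hδ hδ1)
  refine ⟨⌈Real.exp x₀⌉₊, fun q _ hq H hH χ₁ => ?_⟩
  have hq0 : (0 : ℝ) < q := by exact_mod_cast (Fact.out : q.Prime).pos
  obtain ⟨hx3, hCx, herr, hlarge, hlogx⟩ := hx₀ (Real.log q)
    ((Real.le_log_iff_exp_le hq0).2 (Nat.ceil_le.1 hq))
  have hqexp : (q : ℝ) = Real.exp (Real.log q) := (Real.exp_log hq0).symm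
  have hscale : scaleL q = Real.sqrt (Real.log q / Real.log (Real.log q)) := rfl
  set x := Real.log q with hx
  have hx0 : 0 < x := by linarith
  have hlx : 0 < Real.log x := Real.log_pos (by linarith)
  set K := H.index with hKdef
  have hK : 0 < K := Nat.pos_of_ne_zero Subgroup.index_ne_zero_of_finite
  have hK1 : (1 : ℝ) ≤ K := by exact_mod_cast hK
  have hxε : x ^ (1 - ε) * x ^ ε = x := by
    rw [← Real.rpow_add hx0, sub_add_cancel, Real.rpow_one]
  have hxε0 : 0 < x ^ ε := by positivity
  have hxε1 : 1 ≤ x ^ ε := Real.one_le_rpow (by linarith) hε.le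
  have hKx : (K : ℝ) * x ^ ε ≤ C * x := by
    calc (K : ℝ) * x ^ ε ≤ C * x ^ (1 - ε) * x ^ ε := mul_le_mul_of_nonneg_right hH hxε0.le
      _ = C * x := by rw [mul_assoc, hxε]
  have hKCx : (K : ℝ) ≤ C * x := (le_mul_of_one_le_right (by linarith) hxε1).trans hKx
  -- The value 1 covers $K=1$, where the only constraint on $B$ is $B<q$.
  set M := max ((K : ℝ) - 1) 1 with hM
  have hM1 : 1 ≤ M := le_max_right _ _
  have hM0 : 0 < M := by linarith
  have hMK : M ≤ K := max_le (by linarith) hK1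
  have hKM : (K : ℝ) - 1 ≤ M := le_max_left _ _
  set t := x / M with ht
  have htx : t ≤ x := div_le_self hx0.le hM1
  have htε : x ^ ε / C ≤ t := by
    rw [ht, div_le_div_iff₀ hC hM0, mul_comm, mul_comm x]
    exact (mul_le_mul_of_nonneg_right hMK hxε0.le).trans hKx
  have ht0 : 0 < t := div_pos hx0 hM0
  have htK : t * ((K : ℝ) - 1) ≤ x := by
    calc t * ((K : ℝ) - 1) ≤ t * M := mul_le_mul_of_nonneg_left hKM ht0.le
      _ = x := div_mul_cancel₀ x hM0.ne'
  -- The split gives $L_0N=e^{(1-\delta/2)t}$, whose $(K-1)$-th power leaves room $q^{\delta/2}$ for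
  -- the factor $K$, and $N/\sqrt{L_0}=e^{-\delta t/4}$, which beats $K$.
  set N := Real.exp ((1 - δ) / 3 * t) with hN
  set L₀ := Real.exp ((2 - δ / 2) / 3 * t) with hL₀
  have hlogN : Real.log N = (1 - δ) / 3 * t := Real.log_exp _
  have hNlarge : max X₀ 2 ≤ Real.log N := by
    rw [hlogN]
    exact hlarge.trans (mul_le_mul_of_nonneg_left htε (div_nonneg (by linarith) (by norm_num)))
  have hN1 : 1 ≤ N := Real.one_le_exp (mul_nonneg (div_nonneg (by linarith) (by norm_num)) ht0.le)
  have hNL : N ≤ L₀ := Real.exp_le_exp.2 (mul_le_mul_of_nonneg_right (by linarith) ht0.le)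
  have hLq : L₀ ≤ q := by
    rw [hqexp, hL₀, Real.exp_le_exp]
    refine (mul_le_of_le_one_left ht0.le ?_).trans htx
    linarith
  have hLN : L₀ * N = Real.exp ((1 - δ / 2) * t) := by
    rw [hL₀, hN, ← Real.exp_add]; congr 1; ring
  have hfloor : (⌊L₀ * N⌋₊ : ℝ) ≤ Real.exp ((1 - δ / 2) * t) := by
    rw [← hLN]; exact Nat.floor_le (by positivity)
  have hB : ⌊L₀ * N⌋₊ < q := by
    have : (⌊L₀ * N⌋₊ : ℝ) < q := by
      refine hfloor.trans_lt ?_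
      rw [hqexp, Real.exp_lt_exp]
      exact (mul_lt_of_lt_one_left ht0 (by linarith)).trans_le htx
    exact_mod_cast this
  have hKB : K * ⌊L₀ * N⌋₊ ^ (K - 1) < q := by
    have h1 : (⌊L₀ * N⌋₊ : ℝ) ^ (K - 1) ≤ Real.exp ((1 - δ / 2) * x) := by
      refine (pow_le_pow_left₀ (Nat.cast_nonneg _) hfloor _).trans ?_
      rw [← Real.exp_nat_mul, Real.exp_le_exp, Nat.cast_pred hK, mul_comm,
        mul_assoc]
      exact mul_le_mul_of_nonneg_left htK (by linarith)
    have h2 : ((K * ⌊L₀ * N⌋₊ ^ (K - 1) : ℕ) : ℝ) < q := by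
      push_cast
      calc (K : ℝ) * (⌊L₀ * N⌋₊ : ℝ) ^ (K - 1) ≤ C * x * Real.exp ((1 - δ / 2) * x) :=
            mul_le_mul hKCx h1 (by positivity) (by positivity)
        _ < Real.exp (δ / 2 * x) * Real.exp ((1 - δ / 2) * x) :=
            mul_lt_mul_of_pos_right hCx (Real.exp_pos _)
        _ = q := by rw [hqexp, ← Real.exp_add]; congr 1; ring
    exact_mod_cast h2
  obtain ⟨r, hr, hr0, hV⟩ := hX₀ N (Real.exp_pos _) ((le_max_left _ _).trans hNlarge)
  obtain ⟨χ, hχ, hge⟩ := exists_mem_coset_norm_LFunction_ge hC' (hcoeff q) H χ₁ hN1 hNL hLq hB hKB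
    hr hr0 hV
  refine ⟨χ, hχ, le_trans ?_ hge⟩
  have herr' : (K : ℝ) * (1 + C') * N / Real.sqrt L₀ ≤ 1 := by
    have h1 : N / Real.sqrt L₀ = Real.exp (-(δ / 4) * t) := by
      rw [hN, hL₀, Real.sqrt_eq_rpow, ← Real.exp_mul, ← Real.exp_sub]
      congr 1
      ring
    rw [mul_div_assoc, h1]
    refine le_trans (mul_le_mul (mul_le_mul_of_nonneg_right hKCx (by linarith))
      (Real.exp_le_exp.2 ?_) (Real.exp_pos _).le (by positivity)) herr
    rw [neg_mul, neg_mul, neg_le_neg_iff, div_mul_eq_mul_div, ← mul_div_assoc']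
    exact mul_le_mul_of_nonneg_left htε (by positivity)
  set Z := scaleL q / Real.sqrt M with hZ
  have hZsq : Z = Real.sqrt (t / Real.log x) := by
    rw [hZ, hscale, ← Real.sqrt_div' _ hM0.le]
    congr 1
    rw [ht, div_right_comm]
  have hZ0 : 0 ≤ Z := hZsq ▸ Real.sqrt_nonneg _
  have hZlarge : 2 / η ≤ Z := by
    rw [hZsq]
    refine Real.le_sqrt_of_sq_le ?_
    rw [le_div_iff₀ hlx]
    refine le_trans ?_ htε
    rw [le_div_iff₀ hC]
    linarith
  have hlogN2 : 2 ≤ Real.log N := (le_max_right _ _).trans hNlarge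
  have hfinal : Real.exp ((1 / Real.sqrt 3 - η) * Z) + 1 ≤
      Real.exp ((1 - δ) * Real.sqrt (Real.log N / Real.log (Real.log N))) := by
    rw [hlogN, hZsq]
    rw [hlogN] at hlogN2
    rw [hZsq] at hZlarge
    exact exp_add_one_le_exp_resonator_exponent hη hη1 hlx ht0 htx hlogN2 hZlarge
  have heq : 1 / Real.sqrt M * (1 / Real.sqrt 3 - η) * scaleL q = (1 / Real.sqrt 3 - η) * Z := by
    rw [hZ]; ring
  rw [heq]
  linarith

theorem exists_isGreatest_centralAbsValues {q : ℕ} [NeZero q]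
    {S : Set (DirichletCharacter ℂ q)} {χ : DirichletCharacter ℂ q} (hχ : χ ∈ S) :
    ∃ M : ℝ, IsGreatest (centralAbsValues S) M ∧
      ‖DirichletCharacter.LFunction χ (1 / 2)‖ ≤ M := by
  obtain ⟨ψ, hψ, hmax⟩ := Set.exists_max_image S
    (fun χ : DirichletCharacter ℂ q => ‖DirichletCharacter.LFunction χ (1 / 2)‖)
    (Set.toFinite S) ⟨χ, hχ⟩
  refine ⟨_, ⟨⟨ψ, hψ, rfl⟩, ?_⟩, hmax χ hχ⟩
  rintro _ ⟨ψ', hψ', rfl⟩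
  exact hmax ψ' hψ'

theorem theorem2 :
    ∀ ε : ℝ, 0 < ε → ∀ C : ℝ, 0 < C → ∀ η : ℝ, 0 < η →
    ∃ q₀ : ℕ, ∀ (q : ℕ) [Fact q.Prime], q₀ ≤ q →
    ∀ H : Subgroup (DirichletCharacter ℂ q),
      (H.index : ℝ) ≤ C * (Real.log q) ^ (1 - ε) →
      -- cosets containing both even and odd characters
      (∀ χ₁ : DirichletCharacter ℂ q,
        (∃ χ ∈ χ₁ • (H : Set (DirichletCharacter ℂ q)), χ.Even) →
        (∃ χ ∈ χ₁ • (H : Set (DirichletCharacter ℂ q)), χ.Odd) →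
        ∃ M : ℝ, IsGreatest (centralAbsValues (χ₁ • (H : Set (DirichletCharacter ℂ q)))) M ∧
          Real.exp (1 / Real.sqrt (2 * (H.index : ℝ) - 1) * (1 / Real.sqrt 3 - η) * scaleL q)
            ≤ M) ∧
      -- cosets contained in the even or in the odd characters
      (∀ χ₂ : DirichletCharacter ℂ q,
        ((∀ χ ∈ χ₂ • (H : Set (DirichletCharacter ℂ q)), χ.Even) ∨
          (∀ χ ∈ χ₂ • (H : Set (DirichletCharacter ℂ q)), χ.Odd)) →
        ∃ M : ℝ, IsGreatest (centralAbsValues (χ₂ • (H : Set (DirichletCharacter ℂ q)))) M ∧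
          Real.exp (1 / Real.sqrt ((H.index : ℝ) - 1) * (1 / Real.sqrt 3 - η) * scaleL q)
            ≤ M) := by
  intro ε hε C hC η hη
  have hs3 : 0 < Real.sqrt 3 := Real.sqrt_pos.2 (by norm_num)
  -- The cap keeps $1/\sqrt3-\eta'\ge0$, so the bound is monotone in the factor in front of it.
  set η' := min η (1 / Real.sqrt 3) with hη'
  have hη'0 : 0 < η' := lt_min hη (by positivity)
  obtain ⟨q₀, hq₀⟩ := eventually_exists_mem_coset_norm_LFunction_ge hε hC hη'0 (min_le_right _ _)
  refine ⟨q₀, fun q _ hq H hH => ?_⟩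
  have hK1 : (1 : ℝ) ≤ H.index := by
    exact_mod_cast Nat.pos_of_ne_zero (Subgroup.index_ne_zero_of_finite (H := H))
  have hscale : 0 ≤ scaleL q := Real.sqrt_nonneg _
  have key : ∀ (χ₁ : DirichletCharacter ℂ q) (a : ℝ), 0 ≤ a →
      a ≤ 1 / Real.sqrt (max ((H.index : ℝ) - 1) 1) →
      ∃ M : ℝ, IsGreatest (centralAbsValues (χ₁ • (H : Set (DirichletCharacter ℂ q)))) M ∧
        Real.exp (a * (1 / Real.sqrt 3 - η) * scaleL q) ≤ M := by
    intro χ₁ a ha0 ha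
    obtain ⟨χ, hχ, hge⟩ := hq₀ q hq H hH χ₁
    obtain ⟨M, hM, hle⟩ := exists_isGreatest_centralAbsValues hχ
    refine ⟨M, hM, le_trans (Real.exp_le_exp.2 ?_) (hge.trans hle)⟩
    refine mul_le_mul_of_nonneg_right ?_ hscale
    calc a * (1 / Real.sqrt 3 - η) ≤ a * (1 / Real.sqrt 3 - η') :=
          mul_le_mul_of_nonneg_left (by linarith [min_le_left η (1 / Real.sqrt 3)]) ha0
      _ ≤ _ := mul_le_mul_of_nonneg_right ha (by linarith [min_le_right η (1 / Real.sqrt 3)])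
  refine ⟨fun χ₁ _ _ => key χ₁ _ (by positivity) ?_, fun χ₂ _ => key χ₂ _ (by positivity) ?_⟩
  · refine one_div_le_one_div_of_le (Real.sqrt_pos.2 (by positivity)) (Real.sqrt_le_sqrt ?_)
    exact max_le (by linarith) (by linarith)
  -- For $K=1$ the conventions $\sqrt0=0$ and $1/0=0$ turn the claim into $M\ge1$.
  · rcases le_or_gt (H.index : ℝ) 1 with h | h
    · rw [show (H.index : ℝ) - 1 = 0 by linarith, Real.sqrt_zero, div_zero]
      positivity
    · have h2 : (2 : ℝ) ≤ H.index := by exact_mod_cast h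
      rw [max_eq_left (by linarith)]
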